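/- **Setting.** Let $x_{t+1}=Ax_t+Bu_t$ with $x_t\in\mathbb R^n$, $u_t\in\mathbb R^m$ partitioned into $M$ local vectors $x_t^i\in\mathbb R^{n_i}$, $u_t^i\in\mathbb R^{m_i}$. Let $\mathcal X=\prod_i\mathcal X_i$, $\mathcal U=\prod_i\mathcal U_i$, where $\mathcal X_i=\{w: C_x^iw\le d_x^i\}$ and $\mathcal U_i=\{w: C_u^iw\le d_u^i\}$ are bounded polytopes and all entries of $d_x^i,d_u^i$ are positive; for $\delta\in[0,1]$ let $(1-\delta)\mathcal X$, $(1-\delta)\mathcal U$ be the sets obtained by replacing $d$ with $(1-\delta)d$. Let $\ell(x,u)=\frac12(x^TQx+u^TRu)$ with $Q=\mathrm{blkdiag}(Q_i)$, $R=\mathrm{blkdiag}(R_i)$, all $Q_i,R_i$ symmetric positive definite; let $\ell^*(x)=\min_{u\in\mathcal U}\ell(x,u)$, and let $\kappa$ be the smallest scalar with $\kappa Q-A^TQA\succeq0$. For a horizon $N\ge1$ let $$V_N^\delta(x)=\min\Big\{\textstyle\sum_{\tau=0}^{N-1}\ell(z_\tau,v_\tau): z_\tau\in(1-\delta)\mathcal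 X,\ v_\tau\in(1-\delta)\mathcal U,\ z_{\tau+1}=Az_\tau+Bv_\tau\ (\tau\le N-2),\ z_0=x\Big\}$$ ($=\infty$ if infeasible), with optimal solution $z^*_\tau(x,\delta),v^*_\tau(x,\delta)$, and $$\mathbb X_N^0=\{x: V_N^0(x)<\infty,\ Az^*_{N-1}(x,0)\in\mathrm{int}(\mathcal X)\}.$$ Let $\Phi_N$ be the smallest constant such that $\ell^*(z^*_{N-1}(x,0))\le\Phi_N\,\ell(x,v_0^*(x,0))$ for all $x\in\mathbb X_N^0$. For $\mathbf v=(v_0,\dots,v_{N-1})$ let $\xi_0=x$, $\xi_{\tau+1}=A\xi_\tau+Bv_\tau$, and let $P_N(x,\mathbf v)=\sum_{\tau=0}^{N-1}\ell(\xi_\tau,v_\tau)$ if all $\xi_\tau\in\mathcal X$ and all $v_\tau\in\mathcal U$, and $P_N(x,\mathbf v)=\infty$ otherwise; let $\mathbf v_s=(v_1,\dots,v_{N-1},0)$. Write the minimization problem in $\mathbf y=(z_0,\dots,z_{N-1},v_0,\dots,v_{N-1})$ as $\min\frac12\mathbf y^T\mathbf H\mathbf y$ subject to $\mathbf A\mathbf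 y=\mathbf bx$ (the rows $z_0=x$ and $z_{\tau+1}-Az_\tau-Bv_\tau=0$) and $\mathbf C\mathbf y\le(1-\delta)\mathbf d$ (the stacked state and control inequalities). Its dual function is $$D_N^\delta(x,\lambda,\mu)=-\tfrac12(\mathbf A^T\lambda+\mathbf C^T\mu)^T\mathbf H^{-1}(\mathbf A^T\lambda+\mathbf C^T\mu)-\lambda^T\mathbf bx-(1-\delta)\mu^T\mathbf d .$$ For given $(x,\delta)$ the dual accelerated gradient iterates start at $\lambda^0=\lambda^{-1}=0$, $\mu^0=\mu^{-1}=0$, $\mathbf y^0=\mathbf y^{-1}=0$ and are given by $$\mathbf y^k=-\mathbf H^{-1}(\mathbf A^T\lambda^k+\mathbf C^T\mu^k),\qquad \bar{\mathbf y}^k=\mathbf y^k+\tfrac{k-1}{k+2}(\mathbf y^k-\mathbf y^{k-1}),$$ $$\lambda^{k+1}=\lambda^k+\tfrac{k-1}{k+2}(\lambda^k-\lambda^{k-1})+\tfrac1L(\mathbf A\bar{\mathbf y}^k-\mathbf bx),$$ $$\mu^{k+1}=\max\big(0,\ \mu^k+\tfrac{k-1}{k+2}(\mu^k-\mu^{k-1})+\tfrac1L(\mathbf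 C\bar{\mathbf y}^k-(1-\delta)\mathbf d)\big),$$ where $L$ is the spectral norm of $\begin{bmatrix}\mathbf A\\ \mathbf C\end{bmatrix}\mathbf H^{-1}\begin{bmatrix}\mathbf A\\ \mathbf C\end{bmatrix}^T$; $\mathbf v^k=(v_0^k,\dots,v_{N-1}^k)$ is the control part of $\mathbf y^k$. **Control law.** Fix $\alpha\in\mathbb R$, $\epsilon>0$, $\delta_{\rm init}\in(0,1]$ and an integer $\Delta k\ge1$. Given $x$, set $k=l=0$, $\delta=\delta_{\rm init}$ and repeat: (i) if $D_N^\delta(x,\lambda^k,\mu^k)\ge P_N(x,\mathbf v^k)-\frac{\epsilon}{l+1}\ell^*(x)$ or $\delta\,\mathbf d^T\mu^k>\epsilon\ell^*(x)$, replace $\delta$ by $\delta/2$ and $l$ by $l+1$, and restart the iteration at $k=0$; (ii) run $\Delta k$ iterations, so that $k$ becomes $k+\Delta k$; until $$D_N^\delta(x,\lambda^k,\mu^k)\ge P_N(Ax+Bv_0^k,\mathbf v_s^k)+\alpha\,\ell(x,v_0^k)\quad\text{and}\quad \delta\,\mathbf d^T\mu^k\le\epsilon\,\ell^*(x).$$ If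 the loop exits after finitely many passes, $\nu_N(x)$ is defined and equals $v_0^k$ at exit; otherwise $\nu_N(x)$ is undefined. **Proposition (one-step feasibility).** Suppose that $$\alpha\le 1-\epsilon-\kappa\,(\sqrt{2\epsilon}+\sqrt{\Phi_N})^2(\sqrt{2\epsilon}+1)^2 .$$ Then for every $x_t\in\mathrm{int}(\mathbb X_N^0)$ the control $\nu_N(x_t)$ is defined, and $x_{t+1}=Ax_t+B\nu_N(x_t)\in\mathcal X$. -/

import Mathlib

noncomputable section

/-- Data of a distributed model predictive control problem with `M` subsystems. Subsystem `i` has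
local state dimension `nx i`, local control dimension `nu i`, and `cx i`, `cu i` linear inequalities
describing its local state and control constraint sets. The global state is indexed by pairs
`⟨i, a⟩` (subsystem, local coordinate), so that `A` and `B` carry the block partition. -/
structure DMPC where
  M : ℕ
  nx : Fin M → ℕ
  nu : Fin M → ℕ
  cx : Fin M → ℕ
  cu : Fin M → ℕ
  A : Matrix ((i : Fin M) × Fin (nx i)) ((i : Fin M) × Fin (nx i)) ℝ
  B : Matrix ((i : Fin M) × Fin (nx i)) ((i : Fin M) × Fin (nu i)) ℝ
  Cx : (i : Fin M) → Matrix (Fin (cx i)) (Fin (nx i)) ℝ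
  dx : (i : Fin M) → Fin (cx i) → ℝ
  Cu : (i : Fin M) → Matrix (Fin (cu i)) (Fin (nu i)) ℝ
  du : (i : Fin M) → Fin (cu i) → ℝ
  Q : (i : Fin M) → Matrix (Fin (nx i)) (Fin (nx i)) ℝ
  R : (i : Fin M) → Matrix (Fin (nu i)) (Fin (nu i)) ℝ

namespace DMPC

open scoped Matrix

section Basic

variable (S : DMPC)

abbrev StateIdx : Type := (i : Fin S.M) × Fin (S.nx i)
abbrev CtrlIdx : Type := (i : Fin S.M) × Fin (S.nu i)
abbrev StateConIdx : Type := (i : Fin S.M) × Fin (S.cx i)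
abbrev CtrlConIdx : Type := (i : Fin S.M) × Fin (S.cu i)
abbrev State : Type := S.StateIdx → ℝ
abbrev Ctrl : Type := S.CtrlIdx → ℝ

/-- The local state constraint set of subsystem `i`. -/
def localStateSet (i : Fin S.M) : Set (Fin (S.nx i) → ℝ) := {w | S.Cx i *ᵥ w ≤ S.dx i}

/-- The local control constraint set of subsystem `i`. -/
def localCtrlSet (i : Fin S.M) : Set (Fin (S.nu i) → ℝ) := {w | S.Cu i *ᵥ w ≤ S.du i}

/-- The tightened state constraint set `(1 - δ) 𝒳`; `δ = 0` gives `𝒳`. -/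
def tightStateSet (δ : ℝ) : Set S.State :=
  {x | ∀ i, S.Cx i *ᵥ (fun a => x ⟨i, a⟩) ≤ (1 - δ) • S.dx i}

/-- The tightened control constraint set `(1 - δ) 𝒰`; `δ = 0` gives `𝒰`. -/
def tightCtrlSet (δ : ℝ) : Set S.Ctrl :=
  {u | ∀ i, S.Cu i *ᵥ (fun a => u ⟨i, a⟩) ≤ (1 - δ) • S.du i}

/-- The global state constraint set `𝒳 = 𝒳₁ × ⋯ × 𝒳_M`. -/
def stateSet : Set S.State := {x | ∀ i, (fun a => x ⟨i, a⟩) ∈ S.localStateSet i}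

/-- The global control constraint set `𝒰 = 𝒰₁ × ⋯ × 𝒰_M`. -/
def ctrlSet : Set S.Ctrl := {u | ∀ i, (fun a => u ⟨i, a⟩) ∈ S.localCtrlSet i}

/-- The separable quadratic stage cost `ℓ(x, u)`. -/
def stageCost (x : S.State) (u : S.Ctrl) : ℝ :=
  (1 / 2) * ∑ i, ((fun a => x ⟨i, a⟩) ⬝ᵥ (S.Q i *ᵥ fun a => x ⟨i, a⟩)
    + (fun a => u ⟨i, a⟩) ⬝ᵥ (S.R i *ᵥ fun a => u ⟨i, a⟩))

/-- `ℓ*(x) = min_{u ∈ 𝒰} ℓ(x, u)`. -/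
def minStageCost (x : S.State) : ℝ := sInf ((fun u => S.stageCost x u) '' S.ctrlSet)

/-- The global state weight `Q = blkdiag(Q₁, …, Q_M)`. -/
def bigQ : Matrix S.StateIdx S.StateIdx ℝ := Matrix.blockDiagonal' S.Q

/-- The global control weight `R = blkdiag(R₁, …, R_M)`. -/
def bigR : Matrix S.CtrlIdx S.CtrlIdx ℝ := Matrix.blockDiagonal' S.R

/-- `κ`, the smallest scalar with `κ Q - Aᵀ Q A ⪰ 0`. -/
def kappa : ℝ := sInf {κ : ℝ | (κ • S.bigQ - S.Aᵀ * S.bigQ * S.A).PosSemidef}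

/-- The infimum defining `ℓ*` is attained at `u = 0`, where it is half the weighted square of `x`. -/
theorem isLeast_minStageCost (hR : ∀ i, (S.R i).PosDef) (hd : ∀ i r, 0 < S.du i r)
    (x : S.State) :
    IsLeast ((fun u => S.stageCost x u) '' S.ctrlSet) (S.minStageCost x) ∧
      S.minStageCost x = S.stageCost x 0 := by
  have h : IsLeast ((fun u => S.stageCost x u) '' S.ctrlSet) (S.stageCost x 0) := by
    refine ⟨⟨0, fun i => ?_, rfl⟩, ?_⟩
    · change S.Cu i *ᵥ (0 : Fin (S.nu i) → ℝ) ≤ S.du i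
      rw [Matrix.mulVec_zero]
      exact fun r => (hd i r).le
    · rintro _ ⟨u, -, rfl⟩
      simp only [stageCost]
      refine mul_le_mul_of_nonneg_left (Finset.sum_le_sum fun i _ => ?_) (by norm_num)
      have h1 := (hR i).posSemidef.dotProduct_mulVec_nonneg (fun a => u ⟨i, a⟩)
      have h2 : (fun a => (0 : S.Ctrl) ⟨i, a⟩) = (0 : Fin (S.nu i) → ℝ) := rfl
      rw [h2, Matrix.mulVec_zero, dotProduct_zero]
      simp only [star_trivial] at h1
      linarith
  have e : S.minStageCost x = S.stageCost x 0 := h.csInf_eq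
  exact ⟨e ▸ h, e⟩

end Basic

/-! From here on the control horizon is `N = T + 1`, and `Fin (T + 1)` is the set of the time
indices `0, …, N - 1`. -/

section Horizon

variable (S : DMPC) (T : ℕ)

/-- Feasibility of the predicted sequences `z`, `v` in the finite horizon problem with initial
state `x` and constraint tightening `δ`. -/
def Feasible (δ : ℝ) (x : S.State) (z : Fin (T + 1) → S.State) (v : Fin (T + 1) → S.Ctrl) : Prop :=
  (∀ τ, z τ ∈ S.tightStateSet δ) ∧ (∀ τ, v τ ∈ S.tightCtrlSet δ) ∧
    (∀ τ : Fin T, z τ.succ = S.A *ᵥ z τ.castSucc + S.B *ᵥ v τ.castSucc) ∧ z 0 = x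

/-- The finite horizon cost. -/
def cost (z : Fin (T + 1) → S.State) (v : Fin (T + 1) → S.Ctrl) : ℝ :=
  ∑ τ, S.stageCost (z τ) (v τ)

/-- The optimal value `V_N^δ(x)`, equal to `⊤` where the problem is infeasible. -/
def value (δ : ℝ) (x : S.State) : EReal :=
  ⨅ (z : Fin (T + 1) → S.State) (v : Fin (T + 1) → S.Ctrl) (_ : S.Feasible T δ x z v),
    ((S.cost T z v : ℝ) : EReal)

/-- `z`, `v` is the (unique, for positive definite weights) optimal solution `z*(x, δ)`,
`v*(x, δ)`. -/
def IsOptimal (δ : ℝ) (x : S.State) (z : Fin (T + 1) → S.State) (v : Fin (T + 1) → S.Ctrl) : Prop :=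
  S.Feasible T δ x z v ∧ ∀ z' v', S.Feasible T δ x z' v' → S.cost T z v ≤ S.cost T z' v'

/-- `𝕏_N^δ = {x | V_N^δ(x) < ∞ and A z*_{N-1}(x, 0) ∈ int 𝒳}`. -/
def feasRegion (δ : ℝ) : Set S.State :=
  {x | S.value T δ x < ⊤ ∧
    ∃ z v, S.IsOptimal T 0 x z v ∧ S.A *ᵥ z (Fin.last T) ∈ interior S.stateSet}

/-- `Φ_N`, the smallest constant such that `ℓ*(z*_{N-1}(x, 0)) ≤ Φ_N ℓ(x, v*_0(x, 0))` for every
`x ∈ 𝕏_N^0`. -/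
def Phi : ℝ :=
  sInf {Φ : ℝ | ∀ x ∈ S.feasRegion T 0, ∀ z v, S.IsOptimal T 0 x z v →
    S.minStageCost (z (Fin.last T)) ≤ Φ * S.stageCost x (v 0)}

/-- The state sequence `ξ` obtained from `x` with the controls `v`. -/
def rollout (x : S.State) (v : Fin (T + 1) → S.Ctrl) (τ : Fin (T + 1)) : S.State :=
  Fin.induction (motive := fun _ => S.State) x
    (fun τ ξ => S.A *ᵥ ξ + S.B *ᵥ v τ.castSucc) τ

open Classical in
/-- The primal cost `P_N(x, v)`. -/
def primalCost (x : S.State) (v : Fin (T + 1) → S.Ctrl) : EReal :=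
  if (∀ τ, S.rollout T x v τ ∈ S.stateSet) ∧ (∀ τ, v τ ∈ S.ctrlSet) then
    ((S.cost T (S.rollout T x v) v : ℝ) : EReal)
  else ⊤

/-- The shifted control sequence `(v_1, …, v_{N-1}, 0)`. -/
def shift (v : Fin (T + 1) → S.Ctrl) : Fin (T + 1) → S.Ctrl :=
  Fin.snoc (α := fun _ => S.Ctrl) (fun τ : Fin T => v τ.succ) 0

/-! ### The compact form: minimize `½ yᵀ H y` subject to `𝐀 y = 𝐛 x`, `𝐂 y ≤ (1 - δ) 𝐝`, with
`y` the stacked vector of all `z_τ` and all `v_τ` -/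

abbrev VarIdx : Type := (S.StateIdx × Fin (T + 1)) ⊕ (S.CtrlIdx × Fin (T + 1))
abbrev EqIdx : Type := S.StateIdx × Fin (T + 1)
abbrev IneqIdx : Type := (S.StateConIdx × Fin (T + 1)) ⊕ (S.CtrlConIdx × Fin (T + 1))

def matH : Matrix (S.VarIdx T) (S.VarIdx T) ℝ :=
  Matrix.fromBlocks (Matrix.blockDiagonal fun _ => S.bigQ) 0 0
    (Matrix.blockDiagonal fun _ => S.bigR)

/-- The rows at time `0` encode `z_0 = x`, those at time `τ + 1` encode
`z_{τ+1} - A z_τ - B v_τ = 0`. -/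
def matA : Matrix (S.EqIdx T) (S.VarIdx T) ℝ :=
  Matrix.fromCols
    (Matrix.of fun p q => (if p = q then 1 else 0)
      - (if (p.2 : ℕ) = (q.2 : ℕ) + 1 then S.A p.1 q.1 else 0))
    (Matrix.of fun p q => - (if (p.2 : ℕ) = (q.2 : ℕ) + 1 then S.B p.1 q.1 else 0))

def matb : Matrix (S.EqIdx T) S.StateIdx ℝ :=
  Matrix.of fun p s => if p.2 = 0 ∧ p.1 = s then 1 else 0

def matC : Matrix (S.IneqIdx T) (S.VarIdx T) ℝ :=
  Matrix.fromBlocks (Matrix.blockDiagonal fun _ => Matrix.blockDiagonal' S.Cx) 0 0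
    (Matrix.blockDiagonal fun _ => Matrix.blockDiagonal' S.Cu)

def vecd : S.IneqIdx T → ℝ :=
  Sum.elim (fun p => S.dx p.1.1 p.1.2) (fun p => S.du p.1.1 p.1.2)

/-- A pair `(λ, μ)` of dual variables. -/
abbrev Dual : Type := (S.EqIdx T → ℝ) × (S.IneqIdx T → ℝ)

/-- `𝐀ᵀ λ + 𝐂ᵀ μ`. -/
def dualGrad (w : S.Dual T) : S.VarIdx T → ℝ :=
  (S.matA T)ᵀ *ᵥ w.1 + (S.matC T)ᵀ *ᵥ w.2

/-- The dual function `D_N^δ(x, λ, μ)`. -/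
def dualFun (δ : ℝ) (x : S.State) (w : S.Dual T) : ℝ :=
  -(1 / 2) * (S.dualGrad T w ⬝ᵥ ((S.matH T)⁻¹ *ᵥ S.dualGrad T w))
    - w.1 ⬝ᵥ (S.matb T *ᵥ x) - (1 - δ) * (w.2 ⬝ᵥ S.vecd T)

/-- `y = -H⁻¹ (𝐀ᵀ λ + 𝐂ᵀ μ)`. -/
def primalOf (w : S.Dual T) : S.VarIdx T → ℝ := -((S.matH T)⁻¹ *ᵥ S.dualGrad T w)

/-- The control sequence contained in a stacked vector `y`. -/
def ctrlOf (y : S.VarIdx T → ℝ) (τ : Fin (T + 1)) : S.Ctrl := fun c => y (Sum.inr (c, τ))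

/-- `L = ‖[𝐀; 𝐂] H⁻¹ [𝐀ᵀ, 𝐂ᵀ]‖` in the induced Euclidean norm. -/
def lipConst : ℝ :=
  ‖Matrix.toEuclideanCLM (n := S.EqIdx T ⊕ S.IneqIdx T) (𝕜 := ℝ)
    (Matrix.fromRows (S.matA T) (S.matC T) * (S.matH T)⁻¹ *
      (Matrix.fromRows (S.matA T) (S.matC T))ᵀ)‖

/-- The momentum factor `(k - 1) / (k + 2)`. -/
def momentum (k : ℕ) : ℝ := ((k : ℝ) - 1) / ((k : ℝ) + 2)

/-- One iteration of the dual accelerated gradient method: from `w = (λ^k, μ^k)` and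
`w' = (λ^{k-1}, μ^{k-1})` to `(λ^{k+1}, μ^{k+1})`. -/
def accStep (δ : ℝ) (x : S.State) (k : ℕ) (w w' : S.Dual T) : S.Dual T :=
  let ybar := S.primalOf T w + momentum k • (S.primalOf T w - S.primalOf T w')
  (w.1 + momentum k • (w.1 - w'.1) + (1 / S.lipConst T) • (S.matA T *ᵥ ybar - S.matb T *ᵥ x),
    fun r => max 0 (w.2 r + momentum k * (w.2 r - w'.2 r)
      + (1 / S.lipConst T) * ((S.matC T *ᵥ ybar) r - (1 - δ) * S.vecd T r)))

/-- The pair `((λ^k, μ^k), (λ^{k-1}, μ^{k-1}))`, started at `λ^0 = λ^{-1} = 0`,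
`μ^0 = μ^{-1} = 0` (so that also `y^0 = y^{-1} = 0`). -/
def accPair (δ : ℝ) (x : S.State) : ℕ → S.Dual T × S.Dual T
  | 0 => (0, 0)
  | k + 1 => (S.accStep T δ x k (accPair δ x k).1 (accPair δ x k).2, (accPair δ x k).1)

/-- The dual iterate `(λ^k, μ^k)` for initial state `x` and tightening `δ`. -/
def dualIter (δ : ℝ) (x : S.State) (k : ℕ) : S.Dual T := (S.accPair T δ x k).1

/-- The control iterate `v^k = (v^k_0, …, v^k_{N-1})`. -/
def ctrlIter (δ : ℝ) (x : S.State) (k : ℕ) : Fin (T + 1) → S.Ctrl :=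
  S.ctrlOf T (S.primalOf T (S.dualIter T δ x k))

end Horizon

/-! ### The stopping condition -/

/-- The parameters: performance `α`, tolerance `ε`, initial tightening `δinit`, and the number `dk`
of iterations between two tests. -/
structure Params where
  α : ℝ
  ε : ℝ
  δinit : ℝ
  dk : ℕ

/-- The counters `k` (iterations since the last reset) and `l` (number of reductions of `δ`). -/
structure Counters where
  k : ℕ
  l : ℕ

section Stopping

variable (S : DMPC) (T : ℕ) (p : Params)

/-- The current tightening: `δinit` halved `l` times. -/
def Params.delta (p : Params) (l : ℕ) : ℝ := p.δinit / 2 ^ l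

/-- The condition under which the tightening is reduced. -/
def ReduceTest (x : S.State) (s : Counters) : Prop :=
  S.primalCost T x (S.ctrlIter T (p.delta s.l) x s.k)
      - ((p.ε / ((s.l : ℝ) + 1) * S.minStageCost x : ℝ) : EReal)
    ≤ ((S.dualFun T (p.delta s.l) x (S.dualIter T (p.delta s.l) x s.k) : ℝ) : EReal) ∨
  p.ε * S.minStageCost x
    < p.delta s.l * (S.vecd T ⬝ᵥ (S.dualIter T (p.delta s.l) x s.k).2)

/-- The exit condition of the loop. -/
def StopTest (x : S.State) (s : Counters) : Prop :=
  S.primalCost T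
        (S.A *ᵥ x + S.B *ᵥ S.ctrlIter T (p.delta s.l) x s.k 0)
        (S.shift T (S.ctrlIter T (p.delta s.l) x s.k))
      + ((p.α * S.stageCost x (S.ctrlIter T (p.delta s.l) x s.k 0) : ℝ) : EReal)
    ≤ ((S.dualFun T (p.delta s.l) x (S.dualIter T (p.delta s.l) x s.k) : ℝ) : EReal) ∧
  p.delta s.l * (S.vecd T ⬝ᵥ (S.dualIter T (p.delta s.l) x s.k).2) ≤ p.ε * S.minStageCost x

open Classical in
/-- One pass through the body of the loop: if the reduction test holds, halve `δ`, increase `l` and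
reset `k` to `0`; then run `dk` iterations of the gradient method. -/
def loopBody (x : S.State) (s : Counters) : Counters :=
  if S.ReduceTest T p x s then ⟨0 + p.dk, s.l + 1⟩ else ⟨s.k + p.dk, s.l⟩

/-- The counters after `j` passes through the loop. -/
def loopState (x : S.State) (j : ℕ) : Counters := (S.loopBody T p x)^[j] ⟨0, 0⟩

open Classical in
/-- The feedback law `ν_N`, a partial function: it is defined at `x` if the loop (do … until) exits
after finitely many passes, and its value is then the control `v^k_0` at the first exit. -/
def feedback : S.State →. S.Ctrl := fun x =>
  ⟨∃ j, S.StopTest T p x (S.loopState T p x (j + 1)), fun h =>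
    let s := S.loopState T p x (Nat.find h + 1)
    S.ctrlIter T (p.delta s.l) x s.k 0⟩

end Stopping

end DMPC

end

/-! Only the finiteness of the loop needs work. At exit, the first test bounds `primalCost` at the
shifted controls by a real number, so the shifted trajectory satisfies all constraints, and its
initial state is the successor state.

If `x = 0`, every iterate vanishes and the exit test reads `0 ≤ 0` (`stopTest_zero`). If `x ≠ 0`,
then `ℓ*(x) > 0`, and termination combines two facts about the loop continued past its exits.

For a fixed tightening `δ`, the reduction test holds for all large `k` (`eventually_reduceTest`). If
the dual function is bounded above, strong duality (`exists_feasible_of_qpDual_bounded`) gives a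
solution of the tightened problem whose cost the dual values approach. Strong convexity carries the
controls along, and since the tightened sets lie in the interior of the original ones, the primal
cost becomes finite and the gap closes. If the dual function is unbounded, the dual values grow
without limit. They differ from dual values of the untightened problem, which are at most the cost
of a feasible point, only by `δ dᵀμ`, so this term becomes large. Hence reductions recur and `l`
grows without bound.

For large `l`, whatever `k` is, the reduction test implies the exit test
(`eventually_stopTest_of_reduceTest`). Interiority of `x` gives a strictly feasible trajectory,
hence a bound on `dᵀμ` uniform in `k`, so `δ dᵀμ → 0` and only the small-gap alternative can hold.
This forces the controls to the untightened optimum. There the shifted trajectory ends at `A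
z*_{N-1}`, interior to the state set and of cost at most `κ Φ ℓ(x, v₀*)`, and the bound on `α` with
`ε > 0` gives `κ Φ < 1 - α`.

The dual iteration is an accelerated projected gradient method with momentum `(k-1)/(k+2)`. Its
convergence is needed even when the dual supremum is infinite or not attained, so the usual rate
relative to a minimizer is unavailable; `IsAccelerated.eventually_lt` supplies a substitute. -/

noncomputable section

open scoped Matrix

/-! ### Accelerated projected gradient method without a minimizer -/

section Accelerated

variable {E : Type*} [NormedAddCommGroup E] [InnerProductSpace ℝ E]

/-- First-order bounds for a convex function `f` with gradient map `g` that is `L`-Lipschitz. -/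
structure IsSmoothConvex (f : E → ℝ) (g : E → E) (L : ℝ) : Prop where
  pos : 0 < L
  lower : ∀ u v, f v + inner ℝ (g v) (u - v) ≤ f u
  upper : ∀ u v, f u ≤ f v + inner ℝ (g v) (u - v) + L / 2 * ‖u - v‖ ^ 2

/-- `w` is the sequence of iterates of the accelerated projected gradient method over `K` with
gradient map `g` and step `1 / L`, and `w'` is the same sequence delayed by one. The projection is
expressed by its variational inequality. -/
structure IsAccelerated (K : Set E) (g : E → E) (L : ℝ) (w w' : ℕ → E) : Prop where
  init : w' 0 = w 0
  delay : ∀ k, w' (k + 1) = w k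
  mem : ∀ k, w k ∈ K
  proj : ∀ k, ∀ u ∈ K,
    inner ℝ (w k + DMPC.momentum k • (w k - w' k)
      - (1 / L) • g (w k + DMPC.momentum k • (w k - w' k)) - w (k + 1)) (u - w (k + 1)) ≤ 0

variable {K : Set E} {f : E → ℝ} {g : E → E} {L : ℝ} {w w' : ℕ → E}

/-- The descent inequality of a projected gradient step from `y` to `z`. -/
theorem IsSmoothConvex.descent (hf : IsSmoothConvex f g L) {y z u : E}
    (h : inner ℝ (y - (1 / L) • g y - z) (u - z) ≤ 0) :
    f z ≤ f u + L / 2 * (‖y - u‖ ^ 2 - ‖z - u‖ ^ 2) := by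
  have hL := hf.pos
  have h1 := hf.upper z y
  have h2 := hf.lower u y
  have h3 : L * inner ℝ (y - z) (u - z) - inner ℝ (g y) (u - z) ≤ 0 := by
    have : L * inner ℝ (y - (1 / L) • g y - z) (u - z)
        = L * inner ℝ (y - z) (u - z) - inner ℝ (g y) (u - z) := by
      rw [show y - (1 / L) • g y - z = (y - z) - (1 / L) • g y by abel, inner_sub_left,
        real_inner_smul_left]
      field_simp
    rw [← this]
    exact mul_nonpos_of_nonneg_of_nonpos hL.le h
  have h4 : inner ℝ (g y) (z - y) - inner ℝ (g y) (u - y) = - inner ℝ (g y) (u - z) := by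
    rw [← inner_sub_right, ← inner_neg_right]; congr 1; abel
  have h5 : ‖y - u‖ ^ 2 = ‖y - z‖ ^ 2 - 2 * inner ℝ (y - z) (u - z) + ‖u - z‖ ^ 2 := by
    rw [← norm_sub_sq_real]; congr 2; abel
  rw [norm_sub_rev z y] at h1
  rw [h5, norm_sub_rev z u]
  nlinarith

/-- This is the descent inequality with the current iterate as comparison point. The squared
momentum is at most `1 - 1/(k+2)`; keeping this slack makes the weighted squared steps summable when
the energy is bounded below. -/
theorem IsAccelerated.energy_le (hf : IsSmoothConvex f g L) (hw : IsAccelerated K g L w w')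
    (k : ℕ) :
    f (w (k + 1)) + L / 2 * ‖w (k + 1) - w' (k + 1)‖ ^ 2 + L / 2 * (‖w k - w' k‖ ^ 2 / (k + 2))
      ≤ f (w k) + L / 2 * ‖w k - w' k‖ ^ 2 := by
  have h := hf.descent (hw.proj k (w k) (hw.mem k))
  rw [add_sub_cancel_left, norm_smul, mul_pow, Real.norm_eq_abs, sq_abs] at h
  rw [hw.delay]
  have hb : DMPC.momentum k ^ 2 + 1 / ((k : ℝ) + 2) ≤ 1 := by
    have : (0 : ℝ) ≤ k := k.cast_nonneg
    rw [DMPC.momentum, div_pow, div_add_div _ _ (by positivity) (by positivity),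
      div_le_one (by positivity)]
    nlinarith
  have hL := hf.pos
  have : (DMPC.momentum k ^ 2 + 1 / ((k : ℝ) + 2)) * ‖w k - w' k‖ ^ 2 ≤ ‖w k - w' k‖ ^ 2 :=
    mul_le_of_le_one_left (by positivity) hb
  have h2 : (DMPC.momentum k ^ 2 + 1 / ((k : ℝ) + 2)) * ‖w k - w' k‖ ^ 2
    = DMPC.momentum k ^ 2 * ‖w k - w' k‖ ^ 2 + ‖w k - w' k‖ ^ 2 / (k + 2) := by ring
  nlinarith

theorem IsAccelerated.energy_antitone (hf : IsSmoothConvex f g L) (hw : IsAccelerated K g L w w') :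
    Antitone fun k => f (w k) + L / 2 * ‖w k - w' k‖ ^ 2 := by
  refine antitone_nat_of_succ_le fun k => ?_
  have h := hw.energy_le hf k
  have hL := hf.pos
  have : 0 ≤ L / 2 * (‖w k - w' k‖ ^ 2 / (k + 2)) := by positivity
  linarith

theorem IsAccelerated.le_init (hf : IsSmoothConvex f g L) (hw : IsAccelerated K g L w w') (k : ℕ) :
    f (w k) ≤ f (w 0) := by
  have h := hw.energy_antitone hf (Nat.zero_le k)
  simp only [hw.init, sub_self, norm_zero] at h
  have hL := hf.pos
  have : 0 ≤ L / 2 * ‖w k - w' k‖ ^ 2 := by positivity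
  linarith

/-- Nesterov's potential argument for an arbitrary comparison point `u`. With `t = (k+2)/2` the
coefficient produced is `t² - t = ((k+1)² - 1)/4`. The resulting `-1/4` term cannot be dropped,
because `f (w k) - f u` may be negative. -/
theorem IsAccelerated.lyapunov_le (hK : Convex ℝ K) (hf : IsSmoothConvex f g L)
    (hw : IsAccelerated K g L w w') {u : E} (hu : u ∈ K) (k : ℕ) :
    (((k + 1 : ℕ) : ℝ) + 1) ^ 2 / 4 * (f (w (k + 1)) - f u)
      + L / 2 * ‖((((k + 1 : ℕ) : ℝ) + 1) / 2) • w (k + 1)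
          - ((((k + 1 : ℕ) : ℝ) - 1) / 2) • w' (k + 1) - u‖ ^ 2
    ≤ ((k : ℝ) + 1) ^ 2 / 4 * (f (w k) - f u)
      + L / 2 * ‖(((k : ℝ) + 1) / 2) • w k - (((k : ℝ) - 1) / 2) • w' k - u‖ ^ 2
      - 1 / 4 * (f (w k) - f u) := by
  have hk : (0 : ℝ) ≤ k := k.cast_nonneg
  have hk2 : (k : ℝ) + 2 ≠ 0 := by positivity
  -- The descent inequality is applied to the convex combination of `w k` and `u` with weight `a =
  -- 1/t`. Multiplied by `t`, the distances to this point are exactly the two potential vectors, as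
  -- `e1` and `e2` record.
  set a : ℝ := 2 / (k + 2) with ha
  have ha0 : 0 ≤ a := by positivity
  have ha1 : a ≤ 1 := by rw [ha, div_le_one (by positivity)]; linarith
  have hat : a * (((k : ℝ) + 2) / 2) = 1 := by rw [ha]; field_simp
  set t : ℝ := ((k : ℝ) + 2) / 2 with ht
  have ht1 : 1 ≤ t := by rw [ht]; linarith
  have hmem : (1 - a) • w k + a • u ∈ K := hK (hw.mem k) hu (by linarith) ha0 (by ring)
  have h := hf.descent (hw.proj k _ hmem)
  have hconv : f ((1 - a) • w k + a • u) ≤ (1 - a) * f (w k) + a * f u := by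
    have h1 := hf.lower (w k) ((1 - a) • w k + a • u)
    have h2 := hf.lower u ((1 - a) • w k + a • u)
    set c := (1 - a) • w k + a • u with hc
    have h3 : (1 - a) * inner ℝ (g c) (w k - c) + a * inner ℝ (g c) (u - c) = 0 := by
      rw [← real_inner_smul_right, ← real_inner_smul_right, ← inner_add_right]
      have : (1 - a) • (w k - c) + a • (u - c) = 0 := by rw [hc]; module
      rw [this, inner_zero_right]
    nlinarith [mul_le_mul_of_nonneg_left h1 (by linarith : 0 ≤ 1 - a),
      mul_le_mul_of_nonneg_left h2 ha0]
  have e1 : ‖(((k : ℝ) + 1) / 2) • w k - (((k : ℝ) - 1) / 2) • w' k - u‖ ^ 2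
      = t ^ 2 * ‖w k + DMPC.momentum k • (w k - w' k) - ((1 - a) • w k + a • u)‖ ^ 2 := by
    rw [← sq_abs t, ← Real.norm_eq_abs, ← mul_pow, ← norm_smul]
    congr 2
    have hm : t * DMPC.momentum k = ((k : ℝ) - 1) / 2 := by
      rw [ht, DMPC.momentum]; field_simp
    rw [smul_sub, smul_add, smul_add, smul_smul, smul_smul, smul_smul, hm, mul_comm t a, hat,
      mul_sub, mul_comm t a, hat, ht]
    module
  have e2 : ‖((((k + 1 : ℕ) : ℝ) + 1) / 2) • w (k + 1)
          - ((((k + 1 : ℕ) : ℝ) - 1) / 2) • w' (k + 1) - u‖ ^ 2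
      = t ^ 2 * ‖w (k + 1) - ((1 - a) • w k + a • u)‖ ^ 2 := by
    rw [← sq_abs t, ← Real.norm_eq_abs, ← mul_pow, ← norm_smul, hw.delay]
    congr 2
    push_cast
    rw [smul_sub, smul_add, smul_smul, smul_smul, mul_comm t a, hat, mul_sub, mul_comm t a, hat, ht]
    module
  rw [e1, e2]
  push_cast
  set X := ‖w k + DMPC.momentum k • (w k - w' k) - ((1 - a) • w k + a • u)‖ ^ 2
  set Y := ‖w (k + 1) - ((1 - a) • w k + a • u)‖ ^ 2
  have h6 : f (w (k + 1)) - f u ≤ (1 - a) * (f (w k) - f u) + L / 2 * (X - Y) := by linarith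
  have h7 := mul_le_mul_of_nonneg_left h6 (sq_nonneg t)
  have e3 : t ^ 2 * ((1 - a) * (f (w k) - f u) + L / 2 * (X - Y))
     = (t ^ 2 - t * (a * t)) * (f (w k) - f u) + L / 2 * (t ^ 2 * X) - L / 2 * (t ^ 2 * Y) := by
    ring
  rw [e3, hat] at h7
  rw [ht] at h7 ⊢
  linarith

/-- The objective values of the accelerated projected gradient method converge to the infimum, also
if it is not attained or `-∞`. -/
theorem IsAccelerated.eventually_lt (hK : Convex ℝ K) (hf : IsSmoothConvex f g L)
    (hw : IsAccelerated K g L w w') {u : E} (hu : u ∈ K) {c : ℝ} (hc : 0 < c) :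
    ∀ᶠ k in Filter.atTop, f (w k) < f u + c := by
  have hL := hf.pos
  -- The energy dominates `f` and is antitone, so one index suffices.
  suffices h : ∃ k, f (w k) + L / 2 * ‖w k - w' k‖ ^ 2 < f u + c by
    obtain ⟨k₀, h⟩ := h
    filter_upwards [Filter.eventually_ge_atTop k₀] with k hk
    have h1 := hw.energy_antitone hf hk
    have : 0 ≤ L / 2 * ‖w k - w' k‖ ^ 2 := by positivity
    simp only at h1
    linarith
  by_contra! h
  set d : ℕ → ℝ := fun k => ‖w k - w' k‖ ^ 2 with hd
  have hd0 : ∀ k, 0 ≤ d k := fun k => by positivity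
  have hsum : ∀ n, L / 2 * ∑ k ∈ Finset.range n, d k / (k + 2)
      ≤ f (w 0) - (f (w n) + L / 2 * d n) := by
    intro n
    induction n with
    | zero => simp [hd, hw.init]
    | succ n ih =>
      have := hw.energy_le hf n
      rw [Finset.sum_range_succ, mul_add]
      simp only [hd] at ih ⊢
      linarith
  set C : ℝ := (2 / L) * (f (w 0) - f u) with hC
  -- Under the contrary assumption the energy stays above `f u`, so the telescoped losses are
  -- bounded.
  have hsumC : ∀ n, ∑ k ∈ Finset.range n, d k / (k + 2) ≤ C := by
    intro n
    have h1 := hsum n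
    have h2 := h n
    have : L / 2 * ∑ k ∈ Finset.range n, d k / (k + 2) ≤ f (w 0) - f u := by
      simp only [hd] at h1 ⊢
      linarith
    calc _ = (2 / L) * (L / 2 * ∑ k ∈ Finset.range n, d k / (k + 2)) := by field_simp
      _ ≤ _ := mul_le_mul_of_nonneg_left this (by positivity)
  have hC0 : 0 ≤ C := by simpa using hsumC 0
  set Λ : ℕ → ℝ := fun k => ((k : ℝ) + 1) ^ 2 / 4 * (f (w k) - f u)
      + L / 2 * ‖(((k : ℝ) + 1) / 2) • w k - (((k : ℝ) - 1) / 2) • w' k - u‖ ^ 2 with hΛ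
  -- The contrary assumption gives `f (w k) - f u ≥ c - L/2 * d k`, so the potential rises by at
  -- most `L/8 * d k` per step. The factor `n + 1` pays for passing from `d k` to the summable `d k
  -- / (k + 2)`.
  have hΛle : ∀ n : ℕ, Λ n ≤ Λ 0 + L / 8 * ((n : ℝ) + 1) * ∑ k ∈ Finset.range n, d k / (k + 2) := by
    intro n
    induction n with
    | zero => simp
    | succ n ih =>
      have h1 := hw.lyapunov_le hK hf hu n
      have h2 := h n
      have h3 : Λ (n + 1) ≤ Λ n + L / 8 * d n := by
        simp only [hΛ, hd]
        linarith
      have hn : (0 : ℝ) ≤ n := n.cast_nonneg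
      have h4 : 0 ≤ ∑ k ∈ Finset.range n, d k / (k + 2) :=
        Finset.sum_nonneg fun k _ => div_nonneg (hd0 k) (by positivity)
      rw [Finset.sum_range_succ]
      push_cast
      have h5 : ((n : ℝ) + 1 + 1) * (d n / (n + 2)) = d n := by field_simp; ring
      have h6 : L / 8 * ((n : ℝ) + 1 + 1) * (∑ k ∈ Finset.range n, d k / (k + 2) + d n / (n + 2))
        = L / 8 * ((n : ℝ) + 1) * (∑ k ∈ Finset.range n, d k / (k + 2))
          + L / 8 * (∑ k ∈ Finset.range n, d k / (k + 2))
          + L / 8 * (((n : ℝ) + 1 + 1) * (d n / (n + 2))) := by ring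
      rw [h6, h5]
      have : 0 ≤ L / 8 * (∑ k ∈ Finset.range n, d k / (k + 2)) := by positivity
      linarith
  set M : ℝ := |Λ 0| + L / 8 * C with hM
  -- The potential grows at most linearly but contains a quadratic multiple of `f (w n) - f u`. So
  -- the squared steps cannot become small, which will contradict their weighted summability through
  -- the harmonic series.
  have hlow : ∀ n : ℕ, c - L / 2 * d n ≤ 4 * M / (n + 1) := by
    intro n
    have hn : (0 : ℝ) < (n : ℝ) + 1 := by positivity
    have h1 := hΛle n
    have h2 := h n
    have h3 : ((n : ℝ) + 1) ^ 2 / 4 * (c - L / 2 * d n) ≤ Λ n := by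
      have : ((n : ℝ) + 1) ^ 2 / 4 * (c - L / 2 * d n) ≤ ((n : ℝ) + 1) ^ 2 / 4 * (f (w n) - f u) :=
        mul_le_mul_of_nonneg_left (by simp only [hd]; linarith) (by positivity)
      have h4 : 0 ≤ L / 2 * ‖(((n : ℝ) + 1) / 2) • w n - (((n : ℝ) - 1) / 2) • w' n - u‖ ^ 2 := by
        positivity
      simp only [hΛ]
      linarith
    have h5 : L / 8 * ((n : ℝ) + 1) * ∑ k ∈ Finset.range n, d k / (k + 2)
        ≤ L / 8 * ((n : ℝ) + 1) * C := mul_le_mul_of_nonneg_left (hsumC n) (by positivity)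
    have h6 : |Λ 0| ≤ |Λ 0| * ((n : ℝ) + 1) := by
      have : (0 : ℝ) ≤ n := n.cast_nonneg
      nlinarith [abs_nonneg (Λ 0)]
    have h7 : ((n : ℝ) + 1) ^ 2 / 4 * (c - L / 2 * d n) ≤ M * (n + 1) := by
      have := le_abs_self (Λ 0)
      rw [hM]
      linarith
    rw [le_div_iff₀ hn]
    have h8 : ((n : ℝ) + 1) * ((c - L / 2 * d n) * (n + 1)) ≤ (n + 1) * (4 * M) := by linarith
    exact le_of_mul_le_mul_left h8 hn
  obtain ⟨n₀, hn₀⟩ := exists_nat_gt (8 * M / c)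
  have hdlow : ∀ n, n₀ ≤ n → c / L ≤ d n := by
    intro n hn
    have h1 := hlow n
    have hn' : (n₀ : ℝ) ≤ n := by exact_mod_cast hn
    have h2 : 4 * M / ((n : ℝ) + 1) ≤ c / 2 := by
      rw [div_le_iff₀ (by positivity)]
      rw [div_lt_iff₀ hc] at hn₀
      nlinarith
    rw [div_le_iff₀ hL]
    linarith
  have htop := Real.tendsto_sum_range_one_div_nat_succ_atTop
  have hbound : ∀ n, ∑ i ∈ Finset.range n, (1 : ℝ) / (i + 1)
      ≤ ∑ i ∈ Finset.range (n₀ + 1), (1 : ℝ) / (i + 1) + 2 * L / c * C := by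
    intro n
    have hterm : ∀ i ∈ Finset.range n, (1 : ℝ) / (i + 1)
        ≤ (if i ∈ Finset.range (n₀ + 1) then (1 : ℝ) / (i + 1) else 0)
          + 2 * L / c * (d i / (i + 2)) := by
      intro i _
      have h0 : 0 ≤ 2 * L / c * (d i / (i + 2)) :=
        mul_nonneg (by positivity) (div_nonneg (hd0 i) (by positivity))
      split_ifs with hi
      · linarith
      · have h1 := hdlow i (by simp at hi; omega)
        have h2 : 2 * L / c * (c / L / (i + 2)) ≤ 2 * L / c * (d i / (i + 2)) := by gcongr
        have h3 : (1 : ℝ) / (i + 1) ≤ 2 * L / c * (c / L / (i + 2)) := by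
          have : 2 * L / c * (c / L / ((i : ℝ) + 2)) = 2 / (i + 2) := by field_simp
          rw [this, div_le_div_iff₀ (by positivity) (by positivity)]
          have : (0 : ℝ) ≤ i := i.cast_nonneg
          linarith
        linarith
    refine (Finset.sum_le_sum hterm).trans ?_
    rw [Finset.sum_add_distrib, ← Finset.mul_sum]
    refine add_le_add ?_ (mul_le_mul_of_nonneg_left (hsumC n) (by positivity))
    rw [← Finset.sum_filter]
    refine Finset.sum_le_sum_of_subset_of_nonneg (fun i hi => ?_) fun i _ _ => by positivity
    exact (Finset.mem_filter.1 hi).2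
  obtain ⟨n, hn⟩ := (htop.eventually_gt_atTop
    (∑ i ∈ Finset.range (n₀ + 1), (1 : ℝ) / (i + 1) + 2 * L / c * C)).exists
  exact absurd (hbound n) (not_le.2 hn)

end Accelerated

/-! ### Regularized minimization -/

section Prox

variable {E : Type*} [NormedAddCommGroup E] [InnerProductSpace ℝ E]

/-- The Tikhonov regularization of a smooth convex function has a minimizer over a closed convex
set, characterized by its variational inequality. -/
theorem IsSmoothConvex.exists_regularized_minimizer [ProperSpace E] {f : E → ℝ} {g : E → E} {L : ℝ}
    (hf : IsSmoothConvex f g L) (hfc : Continuous f) {K : Set E} (hK : Convex ℝ K)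
    (hKc : IsClosed K) (h0 : (0 : E) ∈ K) {τ : ℝ} (hτ : 0 < τ) :
    ∃ w ∈ K, ∀ u ∈ K, 0 ≤ inner ℝ (g w + τ • w) (u - w) := by
  set F : E → ℝ := fun w => f w + τ / 2 * ‖w‖ ^ 2 with hF
  have hFc : Continuous F := by fun_prop
  -- The lower bound for `f` at `0` is affine, so the quadratic term makes `F` coercive.
  have hcomp : IsCompact (K ∩ {w | F w ≤ F 0}) := by
    refine (isCompact_closedBall (0 : E) (2 * ‖g 0‖ / τ)).of_isClosed_subset
      (hKc.inter (isClosed_le hFc continuous_const)) fun w hw => ?_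
    rw [mem_closedBall_zero_iff, le_div_iff₀ hτ]
    have h1 : F w ≤ F 0 := hw.2
    have h2 := hf.lower w 0
    have h3 := neg_le_of_abs_le (abs_real_inner_le_norm (g 0) (w - 0))
    simp only [hF, norm_zero, sub_zero] at h1 h2 h3
    by_contra! hlt
    have hwpos : 0 < ‖w‖ := by
      rcases (norm_nonneg w).eq_or_lt with h | h
      · rw [← h] at hlt; nlinarith [norm_nonneg (g 0)]
      · exact h
    nlinarith [mul_pos hwpos (sub_pos.2 hlt)]
  obtain ⟨w, hw, hmin⟩ := hcomp.exists_isMinOn ⟨0, h0, le_refl (F 0)⟩ hFc.continuousOn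
  have hmin' : ∀ u ∈ K, F w ≤ F u := by
    intro u hu
    by_cases h : F u ≤ F 0
    · exact hmin ⟨hu, h⟩
    · exact hw.2.trans (not_le.1 h).le
  refine ⟨w, hw.1, fun u hu => ?_⟩
  have hexp : ∀ t : ℝ, 0 < t → t ≤ 1 →
      0 ≤ inner ℝ (g w + τ • w) (u - w) + t * ((L + τ) / 2 * ‖u - w‖ ^ 2) := by
    intro t ht ht1
    have hmem : w + t • (u - w) ∈ K := by
      have := hK hw.1 hu (sub_nonneg.2 ht1) ht.le (by ring)
      convert this using 1; module
    have h1 := hmin' _ hmem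
    have h2 := hf.upper (w + t • (u - w)) w
    have h3 := norm_add_sq_real w (t • (u - w))
    simp only [hF] at h1
    rw [add_sub_cancel_left, real_inner_smul_right, norm_smul, mul_pow, Real.norm_eq_abs,
      sq_abs] at h2
    rw [h3, real_inner_smul_right, norm_smul, mul_pow, Real.norm_eq_abs, sq_abs] at h1
    rw [inner_add_left, real_inner_smul_left]
    have h4 : 0 ≤ t * (inner ℝ (g w) (u - w) + τ * inner ℝ w (u - w)
        + t * ((L + τ) / 2 * ‖u - w‖ ^ 2)) := by linarith
    exact nonneg_of_mul_nonneg_right h4 ht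
  by_contra! hneg
  set a := inner ℝ (g w + τ • w) (u - w)
  set b := (L + τ) / 2 * ‖u - w‖ ^ 2
  have hb : 0 ≤ b := mul_nonneg (by linarith [hf.pos]) (sq_nonneg _)
  -- A step this short makes the second-order term at most `-a/2`, too small to compensate a
  -- negative slope `a`.
  have h1 := hexp (min 1 (-a / (2 * (b + 1))))
    (lt_min one_pos (div_pos (by linarith) (by linarith)))
    (min_le_left _ _)
  have h2 : min 1 (-a / (2 * (b + 1))) * b ≤ -a / (2 * (b + 1)) * (b + 1) := by
    gcongr
    · exact (div_pos (by linarith) (by linarith)).le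
    · exact min_le_right _ _
    · linarith
  have h3 : -a / (2 * (b + 1)) * (b + 1) = -a / 2 := by
    have : b + 1 ≠ 0 := by linarith
    field_simp
  linarith

end Prox

/-! ### Bounds for quadratic forms -/

section QuadraticForms

variable {n : Type*} [Fintype n]

theorem Matrix.continuous_dotProduct_mulVec_self (H : Matrix n n ℝ) :
    Continuous fun y : n → ℝ => y ⬝ᵥ (H *ᵥ y) :=
  continuous_id.dotProduct (continuous_const.matrix_mulVec continuous_id)

theorem Matrix.exists_dotProduct_mulVec_le (H : Matrix n n ℝ) :
    ∃ C, ∀ y : n → ℝ, y ⬝ᵥ (H *ᵥ y) ≤ C * ‖y‖ ^ 2 := by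
  refine ⟨∑ i, ∑ j, |H i j|, fun y => ?_⟩
  simp only [dotProduct, Matrix.mulVec, Finset.mul_sum, Finset.sum_mul]
  refine Finset.sum_le_sum fun i _ => Finset.sum_le_sum fun j _ => ?_
  have h1 : |y i| ≤ ‖y‖ := norm_le_pi_norm y i
  have h2 : |y j| ≤ ‖y‖ := norm_le_pi_norm y j
  calc y i * (H i j * y j) ≤ |y i * (H i j * y j)| := le_abs_self _
    _ = |H i j| * (|y i| * |y j|) := by rw [abs_mul, abs_mul]; ring
    _ ≤ |H i j| * (‖y‖ * ‖y‖) := by gcongr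
    _ = _ := by ring

theorem Matrix.PosDef.exists_mul_norm_sq_le {H : Matrix n n ℝ} (hH : H.PosDef) :
    ∃ c, 0 < c ∧ ∀ y : n → ℝ, c * ‖y‖ ^ 2 ≤ y ⬝ᵥ (H *ᵥ y) := by
  have hcomp := isCompact_sphere (0 : n → ℝ) 1
  rcases (Metric.sphere (0 : n → ℝ) 1).eq_empty_or_nonempty with he | hne
  · refine ⟨1, one_pos, fun y => ?_⟩
    have : y = 0 := by
      by_contra hy
      have : ‖y‖⁻¹ • y ∈ Metric.sphere (0 : n → ℝ) 1 := by
        simp [norm_smul, hy]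
      rw [he] at this
      exact this
    simp [this]
  obtain ⟨y₀, hy₀, hmin⟩ := hcomp.exists_isMinOn hne
    (Matrix.continuous_dotProduct_mulVec_self H).continuousOn
  have hy₀0 : y₀ ≠ 0 := by
    rintro rfl
    simp at hy₀
  refine ⟨y₀ ⬝ᵥ (H *ᵥ y₀), by simpa using hH.dotProduct_mulVec_pos hy₀0, fun y => ?_⟩
  by_cases hy : y = 0
  · simp [hy]
  have hpos : 0 < ‖y‖ := norm_pos_iff.2 hy
  have hmem : ‖y‖⁻¹ • y ∈ Metric.sphere (0 : n → ℝ) 1 := by simp [norm_smul, hy]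
  have h := hmin hmem
  simp only [Set.mem_ofPred_eq, Matrix.mulVec_smul, dotProduct_smul, smul_dotProduct,
    smul_eq_mul] at h
  calc _ ≤ ‖y‖⁻¹ * (‖y‖⁻¹ * (y ⬝ᵥ (H *ᵥ y))) * ‖y‖ ^ 2 := by gcongr
    _ = _ := by field_simp

theorem Matrix.PosDef.dotProduct_mulVec_comm {H : Matrix n n ℝ} (hH : H.PosDef)
    (y z : n → ℝ) : y ⬝ᵥ (H *ᵥ z) = z ⬝ᵥ (H *ᵥ y) := by
  have : Hᵀ = H := by simpa using hH.isHermitian.eq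
  rw [Matrix.dotProduct_mulVec, ← Matrix.mulVec_transpose, this, dotProduct_comm]

end QuadraticForms

/-! ### Duality for strictly convex quadratic programs -/

section QuadraticProgram

variable {n m m₁ m₂ : Type*} [Fintype n] [Fintype m] [Fintype m₁] [Fintype m₂]
  [DecidableEq n]

/-- The negative of the dual function of minimizing `½ yᵀ H y` subject to linear constraints
`G y = h` or `G y ≤ h`. -/
def qpDual (H : Matrix n n ℝ) (G : Matrix m n ℝ) (h : m → ℝ) (w : m → ℝ) : ℝ :=
  1 / 2 * ((Gᵀ *ᵥ w) ⬝ᵥ (H⁻¹ *ᵥ (Gᵀ *ᵥ w))) + w ⬝ᵥ h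

/-- The minimizer of the Lagrangian. -/
def qpPrimal (H : Matrix n n ℝ) (G : Matrix m n ℝ) (w : m → ℝ) : n → ℝ :=
  -(H⁻¹ *ᵥ (Gᵀ *ᵥ w))

variable {H : Matrix n n ℝ}

theorem mulVec_qpPrimal (hH : H.PosDef) (G : Matrix m n ℝ) (w : m → ℝ) :
    H *ᵥ qpPrimal H G w = -(Gᵀ *ᵥ w) := by
  rw [qpPrimal, Matrix.mulVec_neg, Matrix.mulVec_mulVec,
    Matrix.mul_nonsing_inv _ ((Matrix.isUnit_iff_isUnit_det _).1 hH.isUnit), Matrix.one_mulVec]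

theorem qpDual_eq (hH : H.PosDef) (G : Matrix m n ℝ) (h : m → ℝ) (w : m → ℝ) :
    qpDual H G h w = 1 / 2 * (qpPrimal H G w ⬝ᵥ (H *ᵥ qpPrimal H G w)) + w ⬝ᵥ h := by
  rw [mulVec_qpPrimal hH, qpDual, qpPrimal, neg_dotProduct_neg, dotProduct_comm]

/-- Weak duality with its gap. -/
theorem qpDual_gap (hH : H.PosDef) (G : Matrix m n ℝ) (h : m → ℝ)
    (w : m → ℝ) (y : n → ℝ) :
    1 / 2 * (y ⬝ᵥ (H *ᵥ y)) = -qpDual H G h w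
      + 1 / 2 * ((y - qpPrimal H G w) ⬝ᵥ (H *ᵥ (y - qpPrimal H G w))) - w ⬝ᵥ (G *ᵥ y - h) := by
  have h1 : y ⬝ᵥ (H *ᵥ qpPrimal H G w) = - (w ⬝ᵥ (G *ᵥ y)) := by
    rw [mulVec_qpPrimal hH, dotProduct_neg, Matrix.dotProduct_mulVec w, ← Matrix.mulVec_transpose,
      dotProduct_comm]
  have h2 := hH.dotProduct_mulVec_comm (qpPrimal H G w) y
  rw [qpDual_eq hH, Matrix.mulVec_sub, sub_dotProduct, dotProduct_sub, dotProduct_sub,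
    dotProduct_sub, h2, h1]
  ring

theorem qpPrimal_quadratic_eq (hH : H.PosDef) (G : Matrix m n ℝ) (w : m → ℝ) :
    qpPrimal H G w ⬝ᵥ (H *ᵥ qpPrimal H G w) = w ⬝ᵥ ((G * H⁻¹ * Gᵀ) *ᵥ w) := by
  rw [mulVec_qpPrimal hH, qpPrimal, neg_dotProduct_neg, ← Matrix.mulVec_mulVec,
    ← Matrix.mulVec_mulVec, Matrix.dotProduct_mulVec w, ← Matrix.mulVec_transpose, dotProduct_comm]

/-- Because the Lagrangian minimizer is linear in the multipliers, extrapolating primal iterates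
amounts to evaluating the dual gradient at extrapolated multipliers. -/
theorem qpPrimal_extrapolate (H : Matrix n n ℝ) (G : Matrix m n ℝ) (b : ℝ) (w w' : m → ℝ) :
    qpPrimal H G (w + b • (w - w')) = qpPrimal H G w + b • (qpPrimal H G w - qpPrimal H G w') := by
  simp only [qpPrimal, Matrix.mulVec_add, Matrix.mulVec_smul, Matrix.mulVec_sub]
  module

/-- The function is quadratic, so its first-order expansion is exact up to half the quadratic form
of `G H⁻¹ Gᵀ`. That form is nonnegative and is bounded by the operator norm. The expansion comes
from subtracting two instances of `qpDual_gap`. -/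
theorem qpDual_isSmoothConvex [DecidableEq m] (hH : H.PosDef) (G : Matrix m n ℝ) (h : m → ℝ)
    {L : ℝ} (hL : 0 < L)
    (hle : ‖Matrix.toEuclideanCLM (n := m) (𝕜 := ℝ) (G * H⁻¹ * Gᵀ)‖ ≤ L) :
    IsSmoothConvex (fun w : EuclideanSpace ℝ m => qpDual H G h w.ofLp)
      (fun w => WithLp.toLp 2 (h - G *ᵥ qpPrimal H G w.ofLp)) L := by
  have hexp : ∀ u v : EuclideanSpace ℝ m, qpDual H G h u.ofLp = qpDual H G h v.ofLp
      + inner ℝ (WithLp.toLp 2 (h - G *ᵥ qpPrimal H G v.ofLp)) (u - v)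
      + 1 / 2 * (qpPrimal H G (u - v).ofLp ⬝ᵥ (H *ᵥ qpPrimal H G (u - v).ofLp)) := by
    intro u v
    have h1 := qpDual_gap hH G h u.ofLp (qpPrimal H G v.ofLp)
    have h2 : qpPrimal H G v.ofLp - qpPrimal H G u.ofLp = - qpPrimal H G (u - v).ofLp := by
      simp only [qpPrimal, WithLp.ofLp_sub, Matrix.mulVec_sub]; abel
    have h3 : inner ℝ (WithLp.toLp 2 (h - G *ᵥ qpPrimal H G v.ofLp)) (u - v)
        = - (u.ofLp ⬝ᵥ (G *ᵥ qpPrimal H G v.ofLp - h))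
          + v.ofLp ⬝ᵥ (G *ᵥ qpPrimal H G v.ofLp - h) := by
      rw [EuclideanSpace.inner_eq_star_dotProduct]
      simp only [WithLp.ofLp_sub, star_trivial, sub_dotProduct, dotProduct_sub]
      ring
    have h4 := qpDual_gap hH G h v.ofLp (qpPrimal H G v.ofLp)
    rw [h2, Matrix.mulVec_neg, neg_dotProduct_neg] at h1
    rw [sub_self, Matrix.mulVec_zero, dotProduct_zero, mul_zero, add_zero] at h4
    rw [h3]
    linarith
  have hquad : ∀ d : EuclideanSpace ℝ m,
      qpPrimal H G d.ofLp ⬝ᵥ (H *ᵥ qpPrimal H G d.ofLp) ≤ L * ‖d‖ ^ 2 := by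
    intro d
    rw [qpPrimal_quadratic_eq hH, ← Matrix.inner_toEuclideanCLM]
    refine (real_inner_le_norm _ _).trans ?_
    calc _ ≤ ‖d‖ * (‖Matrix.toEuclideanCLM (n := m) (𝕜 := ℝ) (G * H⁻¹ * Gᵀ)‖ * ‖d‖) := by
          gcongr
          exact ContinuousLinearMap.le_opNorm _ _
      _ ≤ ‖d‖ * (L * ‖d‖) := by gcongr
      _ = _ := by ring
  refine ⟨hL, fun u v => ?_, fun u v => ?_⟩
  · have := hH.posSemidef.dotProduct_mulVec_nonneg (qpPrimal H G (u - v).ofLp)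
    rw [star_trivial] at this
    have := hexp u v
    linarith
  · have := hexp u v
    have := hquad (u - v)
    linarith

theorem continuous_qpDual (H : Matrix n n ℝ) (G : Matrix m n ℝ) (h : m → ℝ) :
    Continuous fun w : m → ℝ => qpDual H G h w := by
  have h1 : Continuous fun w : m → ℝ => Gᵀ *ᵥ w := continuous_const.matrix_mulVec continuous_id
  exact (continuous_const.mul (h1.dotProduct (continuous_const.matrix_mulVec h1))).add
    (continuous_id.dotProduct continuous_const)

/-- The vectors of multipliers whose components for the inequality constraints are nonnegative. -/
def multiplierCone (m₁ m₂ : Type*) [Fintype m₁] [Fintype m₂] : Set (EuclideanSpace ℝ (m₁ ⊕ m₂)) :=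
  {w | ∀ j, 0 ≤ w (Sum.inr j)}

theorem convex_multiplierCone : Convex ℝ (multiplierCone m₁ m₂) := by
  intro u hu v hv a b ha hb _ j
  simp only [PiLp.add_apply, PiLp.smul_apply, smul_eq_mul]
  exact add_nonneg (mul_nonneg ha (hu j)) (mul_nonneg hb (hv j))

theorem isClosed_multiplierCone : IsClosed (multiplierCone m₁ m₂) := by
  simp only [multiplierCone, Set.ofPred_forall]
  exact isClosed_iInter fun j => isClosed_le continuous_const (by fun_prop)

/-- Strong duality without a constraint qualification: if the dual function is bounded by `M`, there
is a primal feasible point of cost at most `M`. -/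
theorem exists_feasible_of_qpDual_bounded [DecidableEq m₁] [DecidableEq m₂] (hH : H.PosDef)
    (G : Matrix (m₁ ⊕ m₂) n ℝ) (h : m₁ ⊕ m₂ → ℝ) {M : ℝ}
    (hM : ∀ w ∈ multiplierCone m₁ m₂, -qpDual H G h w.ofLp ≤ M) :
    ∃ y : n → ℝ, (∀ i, (G *ᵥ y) (Sum.inl i) = h (Sum.inl i)) ∧
      (∀ j, (G *ᵥ y) (Sum.inr j) ≤ h (Sum.inr j)) ∧ 1 / 2 * (y ⬝ᵥ (H *ᵥ y)) ≤ M := by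
  have h0 : (0 : EuclideanSpace ℝ (m₁ ⊕ m₂)) ∈ multiplierCone m₁ m₂ := fun j => by simp
  have hM0 : 0 ≤ M := by simpa [qpDual] using hM 0 h0
  obtain ⟨c, hc, hcle⟩ := hH.exists_mul_norm_sq_le
  set ρ : (n → ℝ) → ℝ := fun y => ∑ i, |(G *ᵥ y) (Sum.inl i) - h (Sum.inl i)|
    + ∑ j, max 0 ((G *ᵥ y) (Sum.inr j) - h (Sum.inr j)) with hρ
  have hGc : Continuous fun y : n → ℝ => G *ᵥ y := continuous_const.matrix_mulVec continuous_id
  have hρc : Continuous ρ := by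
    refine (continuous_finsetSum _ fun i _ => ?_).add (continuous_finsetSum _ fun j _ => ?_)
    · exact (((continuous_apply _).comp hGc).sub continuous_const).abs
    · exact continuous_const.max (((continuous_apply _).comp hGc).sub continuous_const)
  have hcomp : IsCompact {y : n → ℝ | 1 / 2 * (y ⬝ᵥ (H *ᵥ y)) ≤ M} := by
    refine (isCompact_closedBall (0 : n → ℝ) (√(2 * M / c))).of_isClosed_subset
      (isClosed_le (continuous_const.mul (Matrix.continuous_dotProduct_mulVec_self H))
        continuous_const) fun y hy => ?_
    rw [mem_closedBall_zero_iff]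
    refine Real.le_sqrt_of_sq_le ?_
    rw [le_div_iff₀ hc]
    have := hcle y
    simp only [Set.mem_ofPred_eq] at hy
    linarith
  obtain ⟨y, hy, hmin⟩ := hcomp.exists_isMinOn ⟨0, by simpa using hM0⟩ hρc.continuousOn
  -- The minimal total violation `ρ y` over the compact sublevel set is tested against the
  -- Lagrangian minimizers `z` of regularized dual problems. Stationarity bounds each violation by
  -- `τ * w`, while the dual bound gives `τ |w|² ≤ M`. Hence each violation is at most `√(τ M) ≤ e`
  -- for the chosen `τ`.
  have hbound : ∀ e : ℝ, 0 < e → ρ y ≤ (Fintype.card m₁ + Fintype.card m₂) * e := by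
    intro e he
    have hτ : 0 < e ^ 2 / (M + 1) := by positivity
    set τ := e ^ 2 / (M + 1) with hτdef
    set L := ‖Matrix.toEuclideanCLM (n := m₁ ⊕ m₂) (𝕜 := ℝ) (G * H⁻¹ * Gᵀ)‖ + 1
    obtain ⟨w, hw, hvi⟩ := (qpDual_isSmoothConvex hH G h (L := L) (by positivity)
      (by simp [L])).exists_regularized_minimizer
      ((continuous_qpDual H G h).comp (PiLp.continuous_ofLp 2 _)) convex_multiplierCone
      isClosed_multiplierCone h0 hτ
    set z := qpPrimal H G w.ofLp with hz
    set r := G *ᵥ z - h with hr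
    have hg : WithLp.toLp 2 (h - G *ᵥ z) + τ • w = WithLp.toLp 2 (τ • w.ofLp - r) := by
      ext i; simp [hr]; ring
    have hvi' : ∀ u ∈ multiplierCone m₁ m₂, 0 ≤ (u.ofLp - w.ofLp) ⬝ᵥ (τ • w.ofLp - r) := by
      intro u hu
      have := hvi u hu
      rw [hg, EuclideanSpace.inner_eq_star_dotProduct] at this
      simpa using this
    -- Complementarity: in a cone both `0` and `2 w` are admissible test points.
    have horth : w.ofLp ⬝ᵥ r = τ * (w.ofLp ⬝ᵥ w.ofLp) := by
      have h1 := hvi' 0 h0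
      have h2 := hvi' ((2 : ℝ) • w) fun j => by
        have := hw j
        simp only [PiLp.smul_apply, smul_eq_mul]; linarith
      simp only [WithLp.ofLp_zero, WithLp.ofLp_smul, dotProduct_sub, sub_dotProduct,
        dotProduct_smul, smul_dotProduct, smul_eq_mul, zero_dotProduct] at h1 h2
      linarith
    have hinr : ∀ j, r (Sum.inr j) ≤ τ * w (Sum.inr j) := by
      intro j
      have := hvi' (w + EuclideanSpace.single (Sum.inr j) 1) fun j' => by
        have := hw j'
        simp only [PiLp.add_apply, PiLp.single_apply]
        split_ifs <;> linarith
      simp at this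
      linarith
    have hinl : ∀ i, r (Sum.inl i) = τ * w (Sum.inl i) := by
      intro i
      have h1 := hvi' (w + EuclideanSpace.single (Sum.inl i) 1) fun j' => by
        simpa using hw j'
      have h2 := hvi' (w - EuclideanSpace.single (Sum.inl i) 1) fun j' => by
        simpa using hw j'
      simp at h1 h2
      linarith
    have hval : -qpDual H G h w.ofLp = 1 / 2 * (z ⬝ᵥ (H *ᵥ z)) + τ * (w.ofLp ⬝ᵥ w.ofLp) := by
      have := qpDual_gap hH G h w.ofLp z
      rw [← hz, sub_self, Matrix.mulVec_zero, dotProduct_zero, ← hr, horth] at this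
      linarith
    have hMw := hM w hw
    have hz0 : 0 ≤ z ⬝ᵥ (H *ᵥ z) := by
      simpa using hH.posSemidef.dotProduct_mulVec_nonneg z
    have hww : 0 ≤ w.ofLp ⬝ᵥ w.ofLp := Finset.sum_nonneg fun i _ => mul_self_nonneg _
    have hzmem : z ∈ {y : n → ℝ | 1 / 2 * (y ⬝ᵥ (H *ᵥ y)) ≤ M} := by
      simp only [Set.mem_ofPred_eq]
      nlinarith
    have hτM : τ * M ≤ e ^ 2 := by
      rw [hτdef, div_mul_eq_mul_div, div_le_iff₀ (by positivity)]
      nlinarith [sq_nonneg e]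
    have hcoord : ∀ i, |τ * w i| ≤ e := by
      intro i
      refine abs_le_of_sq_le_sq ?_ he.le
      have h1 : w i * w i ≤ w.ofLp ⬝ᵥ w.ofLp :=
        Finset.single_le_sum (f := fun i => w.ofLp i * w.ofLp i) (fun i _ => mul_self_nonneg _)
          (Finset.mem_univ i)
      have h2 : τ * (w.ofLp ⬝ᵥ w.ofLp) ≤ M := by linarith
      calc (τ * w i) ^ 2 = τ * (τ * (w i * w i)) := by ring
        _ ≤ τ * (τ * (w.ofLp ⬝ᵥ w.ofLp)) := by gcongr
        _ ≤ τ * M := by gcongr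
        _ ≤ e ^ 2 := hτM
    refine (hmin hzmem).trans ?_
    have hs1 : ∑ i, |(G *ᵥ z) (Sum.inl i) - h (Sum.inl i)| ≤ Fintype.card m₁ * e := by
      refine (Finset.sum_le_card_nsmul _ _ e fun i _ => ?_).trans_eq (by simp)
      have : (G *ᵥ z) (Sum.inl i) - h (Sum.inl i) = τ * w (Sum.inl i) := hinl i
      rw [this]
      exact hcoord _
    have hs2 : ∑ j, max 0 ((G *ᵥ z) (Sum.inr j) - h (Sum.inr j)) ≤ Fintype.card m₂ * e := by
      refine (Finset.sum_le_card_nsmul _ _ e fun j _ => max_le he.le ?_).trans_eq (by simp)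
      have : (G *ᵥ z) (Sum.inr j) - h (Sum.inr j) ≤ τ * w (Sum.inr j) := hinr j
      exact this.trans ((le_abs_self _).trans (hcoord _))
    simp only [hρ]
    linarith
  have hρ0 : ρ y ≤ 0 := by
    refine le_of_forall_pos_le_add fun e he => ?_
    set N : ℝ := Fintype.card m₁ + Fintype.card m₂
    have hN : 0 ≤ N := by positivity
    have := hbound (e / (N + 1)) (by positivity)
    have h2 : N * (e / (N + 1)) ≤ e := by
      rw [mul_div_assoc', div_le_iff₀ (by positivity)]; nlinarith
    linarith
  have hn1 : ∀ i, 0 ≤ |(G *ᵥ y) (Sum.inl i) - h (Sum.inl i)| := fun i => abs_nonneg _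
  have hn2 : ∀ j, 0 ≤ max 0 ((G *ᵥ y) (Sum.inr j) - h (Sum.inr j)) := fun j => le_max_left _ _
  have hs1 := Finset.sum_nonneg fun i (_ : i ∈ Finset.univ) => hn1 i
  have hs2 := Finset.sum_nonneg fun j (_ : j ∈ Finset.univ) => hn2 j
  simp only [hρ] at hρ0
  refine ⟨y, fun i => ?_, fun j => ?_, hy⟩
  · have := Finset.single_le_sum (fun i _ => hn1 i) (Finset.mem_univ i)
    exact sub_eq_zero.1 (abs_nonpos_iff.1 (by linarith))
  · have := Finset.single_le_sum (fun j _ => hn2 j) (Finset.mem_univ j)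
    have h3 := (le_max_right 0 ((G *ᵥ y) (Sum.inr j) - h (Sum.inr j))).trans
      (this.trans (by linarith : _ ≤ (0 : ℝ)))
    linarith

end QuadraticProgram

/-! ### Block diagonal matrices -/

section BlockDiagonal

variable {o : Type*} [Fintype o] [DecidableEq o]

theorem Matrix.blockDiagonal'_mulVec_apply {m n : o → Type*} [∀ i, Fintype (n i)]
    (D : ∀ i, Matrix (m i) (n i) ℝ) (v : (Σ i, n i) → ℝ) (p : Σ i, m i) :
    (Matrix.blockDiagonal' D *ᵥ v) p = (D p.1 *ᵥ fun a => v ⟨p.1, a⟩) p.2 := by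
  obtain ⟨i, r⟩ := p
  simp only [Matrix.mulVec, dotProduct]
  rw [Fintype.sum_sigma, Finset.sum_eq_single i]
  · simp
  · intro j _ hj
    exact Finset.sum_eq_zero fun a _ => by
      rw [Matrix.blockDiagonal'_apply_ne _ _ _ hj.symm, zero_mul]
  · simp

theorem Matrix.blockDiagonal_mulVec_apply {m n : Type*} [Fintype n]
    (D : o → Matrix m n ℝ) (v : n × o → ℝ) (p : m × o) :
    (Matrix.blockDiagonal D *ᵥ v) p = (D p.2 *ᵥ fun a => v (a, p.2)) p.1 := by
  obtain ⟨r, i⟩ := p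
  simp only [Matrix.mulVec, dotProduct]
  rw [Fintype.sum_prod_type_right, Finset.sum_eq_single i]
  · simp
  · intro j _ hj
    exact Finset.sum_eq_zero fun a _ => by
      rw [Matrix.blockDiagonal_apply_ne _ _ _ hj.symm, zero_mul]
  · simp

theorem Matrix.dotProduct_blockDiagonal'_mulVec {n : o → Type*} [∀ i, Fintype (n i)]
    (D : ∀ i, Matrix (n i) (n i) ℝ) (v : (Σ i, n i) → ℝ) :
    v ⬝ᵥ (Matrix.blockDiagonal' D *ᵥ v)
      = ∑ i, (fun a => v ⟨i, a⟩) ⬝ᵥ (D i *ᵥ fun a => v ⟨i, a⟩) := by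
  simp only [dotProduct, Fintype.sum_sigma, Matrix.blockDiagonal'_mulVec_apply]

theorem Matrix.dotProduct_blockDiagonal_mulVec {n : Type*} [Fintype n]
    (D : o → Matrix n n ℝ) (v : n × o → ℝ) :
    v ⬝ᵥ (Matrix.blockDiagonal D *ᵥ v)
      = ∑ i, (fun a => v (a, i)) ⬝ᵥ (D i *ᵥ fun a => v (a, i)) := by
  simp only [dotProduct, Fintype.sum_prod_type_right, Matrix.blockDiagonal_mulVec_apply]

theorem Matrix.blockDiagonal'_posDef {n : o → Type*} [∀ i, Fintype (n i)]
    {D : ∀ i, Matrix (n i) (n i) ℝ} (hD : ∀ i, (D i).PosDef) :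
    (Matrix.blockDiagonal' D).PosDef := by
  refine Matrix.PosDef.of_dotProduct_mulVec_pos ?_ fun v hv => ?_
  · rw [Matrix.IsHermitian, Matrix.blockDiagonal'_conjTranspose]
    congr 1
    exact funext fun i => (hD i).isHermitian.eq
  · rw [star_trivial, Matrix.dotProduct_blockDiagonal'_mulVec]
    obtain ⟨⟨i, a⟩, hia⟩ := Function.ne_iff.1 hv
    refine Finset.sum_pos' (fun i _ => ?_) ⟨i, Finset.mem_univ i, ?_⟩
    · simpa using (hD i).posSemidef.dotProduct_mulVec_nonneg fun a => v ⟨i, a⟩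
    · simpa using (hD i).dotProduct_mulVec_pos (x := fun a => v ⟨i, a⟩)
        (Function.ne_iff.2 ⟨a, hia⟩)

theorem Matrix.blockDiagonal_posDef {n : Type*} [Fintype n]
    {D : o → Matrix n n ℝ} (hD : ∀ i, (D i).PosDef) : (Matrix.blockDiagonal D).PosDef := by
  refine Matrix.PosDef.of_dotProduct_mulVec_pos ?_ fun v hv => ?_
  · rw [Matrix.IsHermitian, Matrix.blockDiagonal_conjTranspose]
    congr 1
    exact funext fun i => (hD i).isHermitian.eq
  · rw [star_trivial, Matrix.dotProduct_blockDiagonal_mulVec]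
    obtain ⟨⟨a, i⟩, hia⟩ := Function.ne_iff.1 hv
    refine Finset.sum_pos' (fun i _ => ?_) ⟨i, Finset.mem_univ i, ?_⟩
    · simpa using (hD i).posSemidef.dotProduct_mulVec_nonneg fun a => v (a, i)
    · simpa using (hD i).dotProduct_mulVec_pos (x := fun a => v (a, i))
        (Function.ne_iff.2 ⟨a, hia⟩)

theorem Matrix.dotProduct_fromBlocks_diag_mulVec {m n : Type*} [Fintype m] [Fintype n]
    (A : Matrix m m ℝ) (D : Matrix n n ℝ) (v : m ⊕ n → ℝ) :
    v ⬝ᵥ (Matrix.fromBlocks A 0 0 D *ᵥ v)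
      = (v ∘ Sum.inl) ⬝ᵥ (A *ᵥ (v ∘ Sum.inl)) + (v ∘ Sum.inr) ⬝ᵥ (D *ᵥ (v ∘ Sum.inr)) := by
  rw [Matrix.fromBlocks_mulVec, Matrix.zero_mulVec, Matrix.zero_mulVec, add_zero, zero_add]
  simp only [dotProduct, Fintype.sum_sum_type, Sum.elim_inl, Sum.elim_inr, Function.comp]

theorem Matrix.fromBlocks_diag_posDef {m n : Type*} [Fintype m] [Fintype n]
    {A : Matrix m m ℝ} {D : Matrix n n ℝ} (hA : A.PosDef) (hD : D.PosDef) :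
    (Matrix.fromBlocks A 0 0 D).PosDef := by
  refine Matrix.PosDef.of_dotProduct_mulVec_pos ?_ fun v hv => ?_
  · rw [Matrix.IsHermitian, Matrix.fromBlocks_conjTranspose, hA.isHermitian.eq, hD.isHermitian.eq]
    simp
  · rw [star_trivial, Matrix.dotProduct_fromBlocks_diag_mulVec]
    have h1 : 0 ≤ (v ∘ Sum.inl) ⬝ᵥ (A *ᵥ (v ∘ Sum.inl)) := by
      simpa using hA.posSemidef.dotProduct_mulVec_nonneg (v ∘ Sum.inl)
    have h2 : 0 ≤ (v ∘ Sum.inr) ⬝ᵥ (D *ᵥ (v ∘ Sum.inr)) := by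
      simpa using hD.posSemidef.dotProduct_mulVec_nonneg (v ∘ Sum.inr)
    obtain ⟨i | i, hi⟩ := Function.ne_iff.1 hv
    · have : 0 < (v ∘ Sum.inl) ⬝ᵥ (A *ᵥ (v ∘ Sum.inl)) := by
        simpa using hA.dotProduct_mulVec_pos (x := v ∘ Sum.inl) (Function.ne_iff.2 ⟨i, hi⟩)
      linarith
    · have : 0 < (v ∘ Sum.inr) ⬝ᵥ (D *ᵥ (v ∘ Sum.inr)) := by
        simpa using hD.dotProduct_mulVec_pos (x := v ∘ Sum.inr) (Function.ne_iff.2 ⟨i, hi⟩)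
      linarith

end BlockDiagonal

/-! ### The stacked control problem -/

namespace DMPC

variable (S : DMPC) (T : ℕ)

theorem stageCost_eq (x : S.State) (u : S.Ctrl) :
    S.stageCost x u = 1 / 2 * (x ⬝ᵥ (S.bigQ *ᵥ x) + u ⬝ᵥ (S.bigR *ᵥ u)) := by
  rw [bigQ, bigR, Matrix.dotProduct_blockDiagonal'_mulVec, Matrix.dotProduct_blockDiagonal'_mulVec,
    stageCost, Finset.sum_add_distrib]

theorem continuous_stageCost {X : Type*} [TopologicalSpace X] {f : X → S.State} {g : X → S.Ctrl}
    (hf : Continuous f) (hg : Continuous g) : Continuous fun a => S.stageCost (f a) (g a) := by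
  simp only [stageCost_eq]
  exact continuous_const.mul
    (((Matrix.continuous_dotProduct_mulVec_self _).comp hf).add
      ((Matrix.continuous_dotProduct_mulVec_self _).comp hg))

theorem bigQ_posDef (hQ : ∀ i, (S.Q i).PosDef) : S.bigQ.PosDef := Matrix.blockDiagonal'_posDef hQ

theorem bigR_posDef (hR : ∀ i, (S.R i).PosDef) : S.bigR.PosDef := Matrix.blockDiagonal'_posDef hR

theorem matH_posDef (hQ : ∀ i, (S.Q i).PosDef) (hR : ∀ i, (S.R i).PosDef) :
    (S.matH T).PosDef :=
  Matrix.fromBlocks_diag_posDef (Matrix.blockDiagonal_posDef fun _ => S.bigQ_posDef hQ)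
    (Matrix.blockDiagonal_posDef fun _ => S.bigR_posDef hR)

/-- The state sequence contained in a stacked vector `y`. -/
def stateOf (y : S.VarIdx T → ℝ) (τ : Fin (T + 1)) : S.State := fun s => y (Sum.inl (s, τ))

/-- The stacked vector of a state sequence and a control sequence. -/
def stack (z : Fin (T + 1) → S.State) (v : Fin (T + 1) → S.Ctrl) : S.VarIdx T → ℝ :=
  Sum.elim (fun q => z q.2 q.1) (fun q => v q.2 q.1)

theorem stateOf_stack (z : Fin (T + 1) → S.State) (v : Fin (T + 1) → S.Ctrl) :
    S.stateOf T (S.stack T z v) = z := rfl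

theorem ctrlOf_stack (z : Fin (T + 1) → S.State) (v : Fin (T + 1) → S.Ctrl) :
    S.ctrlOf T (S.stack T z v) = v := rfl

theorem continuous_ctrlOf : Continuous (S.ctrlOf T) :=
  continuous_pi fun _ => continuous_pi fun _ => continuous_apply _

theorem matH_quadratic_eq_cost (y : S.VarIdx T → ℝ) :
    1 / 2 * (y ⬝ᵥ (S.matH T *ᵥ y)) = S.cost T (S.stateOf T y) (S.ctrlOf T y) := by
  rw [matH, Matrix.dotProduct_fromBlocks_diag_mulVec, Matrix.dotProduct_blockDiagonal_mulVec,
    Matrix.dotProduct_blockDiagonal_mulVec, ← Finset.sum_add_distrib, Finset.mul_sum, cost]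
  exact Finset.sum_congr rfl fun τ _ => (S.stageCost_eq _ _).symm

theorem matC_mulVec_inl (y : S.VarIdx T → ℝ) (q : S.StateConIdx × Fin (T + 1)) :
    (S.matC T *ᵥ y) (Sum.inl q)
      = (S.Cx q.1.1 *ᵥ fun a => S.stateOf T y q.2 ⟨q.1.1, a⟩) q.1.2 := by
  rw [matC, Matrix.fromBlocks_mulVec, Sum.elim_inl, Matrix.zero_mulVec, add_zero,
    Matrix.blockDiagonal_mulVec_apply, Matrix.blockDiagonal'_mulVec_apply]
  rfl

theorem matC_mulVec_inr (y : S.VarIdx T → ℝ) (q : S.CtrlConIdx × Fin (T + 1)) :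
    (S.matC T *ᵥ y) (Sum.inr q)
      = (S.Cu q.1.1 *ᵥ fun a => S.ctrlOf T y q.2 ⟨q.1.1, a⟩) q.1.2 := by
  rw [matC, Matrix.fromBlocks_mulVec, Sum.elim_inr, Matrix.zero_mulVec, zero_add,
    Matrix.blockDiagonal_mulVec_apply, Matrix.blockDiagonal'_mulVec_apply]
  rfl

theorem matC_mulVec_le_iff (δ : ℝ) (y : S.VarIdx T → ℝ) :
    (∀ r, (S.matC T *ᵥ y) r ≤ (1 - δ) * S.vecd T r) ↔
      (∀ τ, S.stateOf T y τ ∈ S.tightStateSet δ) ∧ ∀ τ, S.ctrlOf T y τ ∈ S.tightCtrlSet δ := by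
  constructor
  · intro h
    refine ⟨fun τ i r => ?_, fun τ i r => ?_⟩
    · have := h (Sum.inl (⟨i, r⟩, τ))
      rwa [matC_mulVec_inl] at this
    · have := h (Sum.inr (⟨i, r⟩, τ))
      rwa [matC_mulVec_inr] at this
  · rintro ⟨h1, h2⟩ (⟨⟨i, r⟩, τ⟩ | ⟨⟨i, r⟩, τ⟩)
    · rw [matC_mulVec_inl]
      exact h1 τ i r
    · rw [matC_mulVec_inr]
      exact h2 τ i r

theorem matb_mulVec_zero (x : S.State) (s : S.StateIdx) : (S.matb T *ᵥ x) (s, 0) = x s := by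
  simp [matb, Matrix.mulVec, dotProduct]

theorem matb_mulVec_succ (x : S.State) (s : S.StateIdx) (τ : Fin T) :
    (S.matb T *ᵥ x) (s, τ.succ) = 0 := by
  simp [matb, Matrix.mulVec, dotProduct, Fin.succ_ne_zero]

theorem matA_mulVec_zero (y : S.VarIdx T → ℝ) (s : S.StateIdx) :
    (S.matA T *ᵥ y) (s, 0) = S.stateOf T y 0 s := by
  rw [matA, Matrix.fromCols_mulVec]
  simp [Matrix.mulVec, dotProduct, stateOf]

theorem matA_mulVec_succ (y : S.VarIdx T → ℝ) (s : S.StateIdx) (τ : Fin T) :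
    (S.matA T *ᵥ y) (s, τ.succ) = S.stateOf T y τ.succ s
      - (S.A *ᵥ S.stateOf T y τ.castSucc + S.B *ᵥ S.ctrlOf T y τ.castSucc) s := by
  have key : ∀ {J : Type} [Fintype J] (D : J → ℝ) (v : J × Fin (T + 1) → ℝ),
      ∑ q : J × Fin (T + 1), (if (τ : ℕ) = (q.2 : ℕ) then D q.1 else 0) * v q
        = ∑ j, D j * v (j, τ.castSucc) := by
    intro J _ D v
    rw [Fintype.sum_prod_type_right, Finset.sum_eq_single τ.castSucc]
    · simp
    · intro σ _ hσ
      refine Finset.sum_eq_zero fun j _ => ?_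
      rw [if_neg, zero_mul]
      intro h
      exact hσ (Fin.ext h.symm)
    · simp
  rw [matA, Matrix.fromCols_mulVec, Pi.add_apply, Pi.add_apply]
  simp only [Matrix.mulVec, dotProduct, Matrix.of_apply, Fin.val_succ, add_left_inj, sub_mul,
    neg_mul, Finset.sum_sub_distrib, Finset.sum_neg_distrib]
  rw [key, key]
  simp only [ite_mul, one_mul, zero_mul, Finset.sum_ite_eq, Finset.mem_univ, if_true,
    stateOf, ctrlOf, Function.comp]
  ring

theorem matA_mulVec_eq_iff (x : S.State) (y : S.VarIdx T → ℝ) :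
    S.matA T *ᵥ y = S.matb T *ᵥ x ↔
      (∀ τ : Fin T, S.stateOf T y τ.succ
        = S.A *ᵥ S.stateOf T y τ.castSucc + S.B *ᵥ S.ctrlOf T y τ.castSucc) ∧
      S.stateOf T y 0 = x := by
  constructor
  · intro h
    refine ⟨fun τ => funext fun s => ?_, funext fun s => ?_⟩
    · have := congrFun h (s, τ.succ)
      rw [matA_mulVec_succ, matb_mulVec_succ] at this
      exact sub_eq_zero.1 this
    · have := congrFun h (s, 0)
      rwa [matA_mulVec_zero, matb_mulVec_zero] at this
  · rintro ⟨h1, h2⟩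
    ext ⟨s, τ⟩
    induction τ using Fin.cases with
    | zero => rw [matA_mulVec_zero, matb_mulVec_zero, h2]
    | succ τ => rw [matA_mulVec_succ, matb_mulVec_succ, h1, sub_self]

theorem feasible_iff (δ : ℝ) (x : S.State) (y : S.VarIdx T → ℝ) :
    S.Feasible T δ x (S.stateOf T y) (S.ctrlOf T y) ↔
      S.matA T *ᵥ y = S.matb T *ᵥ x ∧ ∀ r, (S.matC T *ᵥ y) r ≤ (1 - δ) * S.vecd T r := by
  rw [matC_mulVec_le_iff, matA_mulVec_eq_iff, Feasible]
  tauto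

/-! ### The dual problem as an instance of quadratic programming duality -/

abbrev conMat : Matrix (S.EqIdx T ⊕ S.IneqIdx T) (S.VarIdx T) ℝ :=
  Matrix.fromRows (S.matA T) (S.matC T)

def conRhs (δ : ℝ) (x : S.State) : S.EqIdx T ⊕ S.IneqIdx T → ℝ :=
  Sum.elim (S.matb T *ᵥ x) ((1 - δ) • S.vecd T)

def dualVec (w : S.Dual T) : S.EqIdx T ⊕ S.IneqIdx T → ℝ := Sum.elim w.1 w.2

theorem conMat_transpose_mulVec (w : S.Dual T) :
    (S.conMat T)ᵀ *ᵥ S.dualVec T w = S.dualGrad T w := by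
  rw [Matrix.transpose_fromRows, dualVec, Matrix.fromCols_mulVec_sumElim, dualGrad]

theorem dualVec_dotProduct (w : S.Dual T) (a : S.EqIdx T → ℝ) (b : S.IneqIdx T → ℝ) :
    S.dualVec T w ⬝ᵥ Sum.elim a b = w.1 ⬝ᵥ a + w.2 ⬝ᵥ b := by
  simp [dualVec, dotProduct, Fintype.sum_sum_type]

theorem dualFun_eq (δ : ℝ) (x : S.State) (w : S.Dual T) :
    S.dualFun T δ x w = -qpDual (S.matH T) (S.conMat T) (S.conRhs T δ x) (S.dualVec T w) := by
  rw [qpDual, conMat_transpose_mulVec, conRhs, dualVec_dotProduct, dualFun, dotProduct_smul,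
    smul_eq_mul]
  ring

theorem primalOf_eq (w : S.Dual T) :
    S.primalOf T w = qpPrimal (S.matH T) (S.conMat T) (S.dualVec T w) := by
  rw [qpPrimal, conMat_transpose_mulVec, primalOf]

/-- The tightening enters the dual function only through an affine term. The same multipliers can
thus be tested against problems with different tightenings, which drives both the reduction test and
the multiplier bound. -/
theorem dualFun_shift (δ δ' : ℝ) (x : S.State) (w : S.Dual T) :
    S.dualFun T δ x w = S.dualFun T δ' x w + (δ - δ') * (S.vecd T ⬝ᵥ w.2) := by
  rw [dualFun, dualFun, dotProduct_comm (S.vecd T)]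
  ring

/-- Weak duality, with the gap controlling the distance of the Lagrangian minimizer. -/
theorem dualFun_add_gap_le (hQ : ∀ i, (S.Q i).PosDef) (hR : ∀ i, (S.R i).PosDef) {δ : ℝ}
    {x : S.State} {z : Fin (T + 1) → S.State} {v : Fin (T + 1) → S.Ctrl}
    (h : S.Feasible T δ x z v) {w : S.Dual T} (hw : ∀ r, 0 ≤ w.2 r) :
    S.dualFun T δ x w + 1 / 2 * ((S.stack T z v - S.primalOf T w) ⬝ᵥ
      (S.matH T *ᵥ (S.stack T z v - S.primalOf T w))) ≤ S.cost T z v := by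
  have h1 := qpDual_gap (S.matH_posDef T hQ hR) (S.conMat T) (S.conRhs T δ x) (S.dualVec T w)
    (S.stack T z v)
  rw [matH_quadratic_eq_cost, ← dualFun_eq, ← primalOf_eq, stateOf_stack, ctrlOf_stack] at h1
  obtain ⟨h2, h3⟩ := (S.feasible_iff T δ x (S.stack T z v)).1 h
  have h4 : S.conMat T *ᵥ S.stack T z v - S.conRhs T δ x
      = Sum.elim (0 : S.EqIdx T → ℝ) (S.matC T *ᵥ S.stack T z v - (1 - δ) • S.vecd T) := by
    rw [Matrix.fromRows_mulVec, h2, conRhs]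
    ext (i | i) <;> simp
  rw [h4, dualVec_dotProduct, dotProduct_zero, zero_add] at h1
  have h5 : w.2 ⬝ᵥ (S.matC T *ᵥ S.stack T z v - (1 - δ) • S.vecd T) ≤ 0 :=
    Finset.sum_nonpos fun r _ => mul_nonpos_of_nonneg_of_nonpos (hw r) (sub_nonpos.2 (h3 r))
  linarith

theorem dualFun_le_cost (hQ : ∀ i, (S.Q i).PosDef) (hR : ∀ i, (S.R i).PosDef) {δ : ℝ}
    {x : S.State} {z : Fin (T + 1) → S.State} {v : Fin (T + 1) → S.Ctrl}
    (h : S.Feasible T δ x z v) {w : S.Dual T} (hw : ∀ r, 0 ≤ w.2 r) :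
    S.dualFun T δ x w ≤ S.cost T z v := by
  have h1 := S.dualFun_add_gap_le T hQ hR h hw
  have h2 := (S.matH_posDef T hQ hR).posSemidef.dotProduct_mulVec_nonneg
    (S.stack T z v - S.primalOf T w)
  rw [star_trivial] at h2
  linarith

/-- If the dual values tend to the cost of a feasible point, the Lagrangian minimizers tend to that
point. -/
theorem tendsto_ctrlOf_primalOf (hQ : ∀ i, (S.Q i).PosDef) (hR : ∀ i, (S.R i).PosDef) {δ : ℝ}
    {x : S.State} {z : Fin (T + 1) → S.State} {v : Fin (T + 1) → S.Ctrl}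
    (h : S.Feasible T δ x z v) {ι : Type*} {F : Filter ι} {w : ι → S.Dual T}
    (hw : ∀ i r, 0 ≤ (w i).2 r)
    (hlim : Filter.Tendsto (fun i => S.dualFun T δ x (w i)) F (nhds (S.cost T z v))) :
    Filter.Tendsto (fun i => S.ctrlOf T (S.primalOf T (w i))) F (nhds v) := by
  obtain ⟨c, hc, hcle⟩ := (S.matH_posDef T hQ hR).exists_mul_norm_sq_le
  have hy : Filter.Tendsto (fun i => S.primalOf T (w i)) F (nhds (S.stack T z v)) := by
    rw [tendsto_iff_norm_sub_tendsto_zero]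
    have h0 : Filter.Tendsto (fun i => √(2 / c * (S.cost T z v - S.dualFun T δ x (w i)))) F
        (nhds 0) := by
      have := ((tendsto_const_nhds (x := S.cost T z v)).sub hlim).const_mul (2 / c)
      rw [sub_self, mul_zero] at this
      simpa using this.sqrt
    -- Strong convexity turns the duality gap into a bound on the squared distance.
    refine squeeze_zero (fun _ => norm_nonneg _) (fun i => Real.le_sqrt_of_sq_le ?_) h0
    have h1 := S.dualFun_add_gap_le T hQ hR h (hw i)
    have h2 := hcle (S.stack T z v - S.primalOf T (w i))
    rw [norm_sub_rev, div_mul_eq_mul_div, le_div_iff₀ hc]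
    linarith
  exact ((S.continuous_ctrlOf T).tendsto _).comp hy

/-! ### Convergence of the dual iterates -/

/-- If the norm vanished, positive definiteness of `H` would force the whole constraint matrix to
vanish. Its rows `z₀ = x` rule this out once the state space is nontrivial, which `x ≠ 0`
guarantees. -/
theorem lipConst_pos (hQ : ∀ i, (S.Q i).PosDef) (hR : ∀ i, (S.R i).PosDef) {x : S.State}
    (hx : x ≠ 0) : 0 < S.lipConst T := by
  have hH := S.matH_posDef T hQ hR
  refine (norm_nonneg _).lt_of_ne' fun h0 => hx ?_
  have hP : S.conMat T * (S.matH T)⁻¹ * (S.conMat T)ᵀ = 0 := by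
    have := norm_eq_zero.1 h0
    exact Matrix.toEuclideanCLM.injective (this.trans (map_zero _).symm)
  have hG : ∀ w, (S.conMat T)ᵀ *ᵥ w = 0 := by
    intro w
    have h1 := qpPrimal_quadratic_eq hH (S.conMat T) w
    rw [hP, Matrix.zero_mulVec, dotProduct_zero] at h1
    have h2 : qpPrimal (S.matH T) (S.conMat T) w = 0 := by
      by_contra hne
      have := hH.dotProduct_mulVec_pos hne
      rw [star_trivial, h1] at this
      exact lt_irrefl _ this
    have h3 := mulVec_qpPrimal hH (S.conMat T) w
    rw [h2, Matrix.mulVec_zero] at h3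
    exact neg_eq_zero.1 h3.symm
  set y := S.stack T (fun _ => x) 0
  have h4 : S.conMat T *ᵥ y = 0 := by
    have : (S.conMat T *ᵥ y) ⬝ᵥ (S.conMat T *ᵥ y) = 0 := by
      rw [Matrix.dotProduct_mulVec, ← Matrix.mulVec_transpose, hG, zero_dotProduct]
    exact dotProduct_self_eq_zero.1 this
  ext s
  have h5 := congrFun h4 (Sum.inl (s, 0))
  rw [Matrix.fromRows_mulVec] at h5
  exact (S.matA_mulVec_zero T y s).symm.trans h5

theorem dualIter_nonneg (δ : ℝ) (x : S.State) (k : ℕ) (r : S.IneqIdx T) :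
    0 ≤ (S.dualIter T δ x k).2 r := by
  cases k with
  | zero => exact le_rfl
  | succ k => exact le_max_left _ _

/-- Projection onto the multiplier cone acts coordinatewise: it leaves equality multipliers
unchanged, so their contribution is zero, and clips inequality multipliers at zero. -/
theorem isAccelerated_dualIter (δ : ℝ) (x : S.State) :
    IsAccelerated (multiplierCone (S.EqIdx T) (S.IneqIdx T))
      (fun w => WithLp.toLp 2
        (S.conRhs T δ x - S.conMat T *ᵥ qpPrimal (S.matH T) (S.conMat T) w.ofLp))
      (S.lipConst T)
      (fun k => WithLp.toLp 2 (S.dualVec T (S.dualIter T δ x k)))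
      (fun k => WithLp.toLp 2 (S.dualVec T (S.accPair T δ x k).2)) := by
  refine ⟨rfl, fun _ => rfl, fun k j => S.dualIter_nonneg T δ x k j, fun k u hu => ?_⟩
  set w := S.dualIter T δ x k with hw
  set w' := (S.accPair T δ x k).2 with hw'
  have hstep : S.dualIter T δ x (k + 1) = S.accStep T δ x k w w' := rfl
  set yb := S.primalOf T w + momentum k • (S.primalOf T w - S.primalOf T w') with hyb
  have hy : qpPrimal (S.matH T) (S.conMat T)
      (WithLp.toLp 2 (S.dualVec T w) + momentum k • (WithLp.toLp 2 (S.dualVec T w)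
        - WithLp.toLp 2 (S.dualVec T w'))).ofLp = yb := by
    simp only [WithLp.ofLp_add, WithLp.ofLp_smul, WithLp.ofLp_sub]
    rw [qpPrimal_extrapolate, ← primalOf_eq, ← primalOf_eq]
  rw [hy, EuclideanSpace.inner_eq_star_dotProduct, star_trivial, dotProduct, Fintype.sum_sum_type]
  refine add_nonpos (Finset.sum_nonpos fun i _ => le_of_eq ?_) (Finset.sum_nonpos fun j _ => ?_)
  · rw [hstep]
    simp only [WithLp.ofLp_add, WithLp.ofLp_smul, WithLp.ofLp_sub, Matrix.fromRows_mulVec, accStep,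
      dualVec, conRhs, Pi.add_apply, Pi.sub_apply, Pi.smul_apply, Sum.elim_inl, smul_eq_mul, ← hyb]
    ring
  · set q := w.2 j + momentum k * (w.2 j - w'.2 j)
      + (1 / S.lipConst T) * ((S.matC T *ᵥ yb) j - (1 - δ) * S.vecd T j) with hq
    have h1 : (WithLp.toLp 2 (S.dualVec T (S.dualIter T δ x (k + 1)))).ofLp (Sum.inr j)
        = max 0 q := rfl
    have h2 : (WithLp.toLp 2 (S.dualVec T w) + momentum k • (WithLp.toLp 2 (S.dualVec T w)
          - WithLp.toLp 2 (S.dualVec T w')) - (1 / S.lipConst T) • WithLp.toLp 2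
          (S.conRhs T δ x - S.conMat T *ᵥ yb)).ofLp (Sum.inr j) = q := by
      simp only [WithLp.ofLp_add, WithLp.ofLp_smul, WithLp.ofLp_sub, Matrix.fromRows_mulVec,
        dualVec, conRhs, Pi.add_apply, Pi.sub_apply, Pi.smul_apply, Sum.elim_inr, smul_eq_mul, hq]
      ring
    rw [WithLp.ofLp_sub, WithLp.ofLp_sub, Pi.sub_apply, Pi.sub_apply, h1, h2]
    have := hu j
    rcases le_total 0 q with h | h
    · simp [max_eq_right h]
    · rw [max_eq_left h]
      nlinarith

theorem dual_isSmoothConvex (hQ : ∀ i, (S.Q i).PosDef) (hR : ∀ i, (S.R i).PosDef)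
    (hL : 0 < S.lipConst T) (δ : ℝ) (x : S.State) :
    IsSmoothConvex (fun w : EuclideanSpace ℝ (S.EqIdx T ⊕ S.IneqIdx T) =>
        qpDual (S.matH T) (S.conMat T) (S.conRhs T δ x) w.ofLp)
      (fun w => WithLp.toLp 2
        (S.conRhs T δ x - S.conMat T *ᵥ qpPrimal (S.matH T) (S.conMat T) w.ofLp))
      (S.lipConst T) :=
  qpDual_isSmoothConvex (S.matH_posDef T hQ hR) _ _ hL le_rfl

/-- The method need not be monotone, but with zero initial velocity it never falls below its
starting dual value, which is `0`. -/
theorem dualFun_dualIter_nonneg (hQ : ∀ i, (S.Q i).PosDef) (hR : ∀ i, (S.R i).PosDef)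
    (hL : 0 < S.lipConst T) (δ : ℝ) (x : S.State) (k : ℕ) :
    0 ≤ S.dualFun T δ x (S.dualIter T δ x k) := by
  have h := (S.isAccelerated_dualIter T δ x).le_init (S.dual_isSmoothConvex T hQ hR hL δ x) k
  have h0 : S.dualFun T δ x (S.dualIter T δ x 0) = 0 := by
    change S.dualFun T δ x 0 = 0
    simp [dualFun, dualGrad]
  rw [dualFun_eq] at h0 ⊢
  simp only at h
  linarith

theorem eventually_lt_dualFun_dualIter (hQ : ∀ i, (S.Q i).PosDef) (hR : ∀ i, (S.R i).PosDef)
    (hL : 0 < S.lipConst T) (δ : ℝ) (x : S.State) {w : S.Dual T} (hw : ∀ r, 0 ≤ w.2 r) {c : ℝ}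
    (hc : c < S.dualFun T δ x w) :
    ∀ᶠ k in Filter.atTop, c < S.dualFun T δ x (S.dualIter T δ x k) := by
  have h := (S.isAccelerated_dualIter T δ x).eventually_lt convex_multiplierCone
    (S.dual_isSmoothConvex T hQ hR hL δ x) (u := WithLp.toLp 2 (S.dualVec T w)) (fun j => hw j)
    (sub_pos.2 hc)
  filter_upwards [h] with k hk
  rw [dualFun_eq] at hk ⊢
  linarith

theorem exists_feasible_of_dualFun_le (hQ : ∀ i, (S.Q i).PosDef) (hR : ∀ i, (S.R i).PosDef)
    {δ : ℝ} {x : S.State} {M : ℝ} (hM : ∀ w : S.Dual T, (∀ r, 0 ≤ w.2 r) → S.dualFun T δ x w ≤ M) :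
    ∃ z v, S.Feasible T δ x z v ∧ S.cost T z v ≤ M := by
  obtain ⟨y, h1, h2, h3⟩ := exists_feasible_of_qpDual_bounded (S.matH_posDef T hQ hR) (S.conMat T)
    (S.conRhs T δ x) (M := M) fun w hw => by
      have := hM (w.ofLp ∘ Sum.inl, w.ofLp ∘ Sum.inr) hw
      rwa [dualFun_eq, dualVec, Sum.elim_comp_inl_inr] at this
  rw [matH_quadratic_eq_cost] at h3
  refine ⟨_, _, (S.feasible_iff T δ x y).2 ⟨funext fun i => ?_, fun j => ?_⟩, h3⟩
  · have := h1 i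
    rwa [Matrix.fromRows_mulVec] at this
  · have := h2 j
    rwa [Matrix.fromRows_mulVec] at this

/-! ### Rollouts and constraint sets -/

@[simp] theorem rollout_zero (x : S.State) (v : Fin (T + 1) → S.Ctrl) :
    S.rollout T x v 0 = x := rfl

theorem rollout_succ (x : S.State) (v : Fin (T + 1) → S.Ctrl) (τ : Fin T) :
    S.rollout T x v τ.succ = S.A *ᵥ S.rollout T x v τ.castSucc + S.B *ᵥ v τ.castSucc :=
  Fin.induction_succ _ _ _

theorem rollout_zero_zero (τ : Fin (T + 1)) : S.rollout T 0 0 τ = 0 := by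
  induction τ using Fin.induction with
  | zero => rfl
  | succ τ ih => rw [rollout_succ, ih]; simp

theorem continuous_rollout {X : Type*} [TopologicalSpace X] {f : X → S.State}
    {g : X → Fin (T + 1) → S.Ctrl} (hf : Continuous f) (hg : Continuous g) (τ : Fin (T + 1)) :
    Continuous fun a => S.rollout T (f a) (g a) τ := by
  induction τ using Fin.induction with
  | zero => exact hf
  | succ τ ih =>
    simp only [rollout_succ]
    exact (continuous_const.matrix_mulVec ih).add
      (continuous_const.matrix_mulVec ((continuous_apply _).comp hg))

theorem continuous_cost_rollout (x : S.State) :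
    Continuous fun v : Fin (T + 1) → S.Ctrl => S.cost T (S.rollout T x v) v := by
  unfold cost
  exact continuous_finsetSum _ fun τ _ => S.continuous_stageCost
    (S.continuous_rollout T continuous_const continuous_id τ) (continuous_apply τ)

theorem tightStateSet_zero : S.tightStateSet 0 = S.stateSet := by
  simp [tightStateSet, stateSet, localStateSet]

theorem tightCtrlSet_zero : S.tightCtrlSet 0 = S.ctrlSet := by
  simp [tightCtrlSet, ctrlSet, localCtrlSet]

theorem Feasible.eq_rollout {S : DMPC} {T : ℕ} {δ : ℝ} {x : S.State} {z : Fin (T + 1) → S.State}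
    {v : Fin (T + 1) → S.Ctrl} (h : S.Feasible T δ x z v) : z = S.rollout T x v := by
  funext τ
  induction τ using Fin.induction with
  | zero => exact h.2.2.2
  | succ τ ih => rw [rollout_succ, h.2.2.1, ih]

theorem feasible_zero_rollout {x : S.State} {v : Fin (T + 1) → S.Ctrl}
    (h1 : ∀ τ, S.rollout T x v τ ∈ S.stateSet) (h2 : ∀ τ, v τ ∈ S.ctrlSet) :
    S.Feasible T 0 x (S.rollout T x v) v :=
  ⟨by rwa [tightStateSet_zero], by rwa [tightCtrlSet_zero], S.rollout_succ T x v, rfl⟩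

/-- Positivity of `d` makes the tightened inequalities strict for the original bounds. -/
theorem stateSet_mem_nhds (hdx : ∀ i r, 0 < S.dx i r) {δ : ℝ} (hδ : 0 < δ) {z : S.State}
    (hz : z ∈ S.tightStateSet δ) : S.stateSet ∈ nhds z := by
  have h : ∀ i r, ∀ᶠ z' : S.State in nhds z, (S.Cx i *ᵥ fun a => z' ⟨i, a⟩) r < S.dx i r := by
    intro i r
    have hc : Continuous fun z' : S.State => (S.Cx i *ᵥ fun a => z' ⟨i, a⟩) r :=
      (continuous_apply r).comp
        (continuous_const.matrix_mulVec
          (continuous_pi fun a => continuous_apply (⟨i, a⟩ : S.StateIdx)))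
    refine hc.continuousAt.eventually_lt_const ((hz i r).trans_lt ?_)
    simp only [Pi.smul_apply, smul_eq_mul]
    nlinarith [hdx i r]
  filter_upwards [Filter.eventually_all.2 fun i => Filter.eventually_all.2 (h i)] with z' hz' i r
  exact (hz' i r).le

theorem ctrlSet_mem_nhds (hdu : ∀ i r, 0 < S.du i r) {δ : ℝ} (hδ : 0 < δ) {u : S.Ctrl}
    (hu : u ∈ S.tightCtrlSet δ) : S.ctrlSet ∈ nhds u := by
  have h : ∀ i r, ∀ᶠ u' : S.Ctrl in nhds u, (S.Cu i *ᵥ fun a => u' ⟨i, a⟩) r < S.du i r := by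
    intro i r
    have hc : Continuous fun u' : S.Ctrl => (S.Cu i *ᵥ fun a => u' ⟨i, a⟩) r :=
      (continuous_apply r).comp
        (continuous_const.matrix_mulVec
          (continuous_pi fun a => continuous_apply (⟨i, a⟩ : S.CtrlIdx)))
    refine hc.continuousAt.eventually_lt_const ((hu i r).trans_lt ?_)
    simp only [Pi.smul_apply, smul_eq_mul]
    nlinarith [hdu i r]
  filter_upwards [Filter.eventually_all.2 fun i => Filter.eventually_all.2 (h i)] with u' hu' i r
  exact (hu' i r).le

theorem zero_mem_tightStateSet : (0 : S.State) ∈ S.tightStateSet 1 := fun i => by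
  have : S.Cx i *ᵥ (0 : Fin (S.nx i) → ℝ) ≤ (1 - 1 : ℝ) • S.dx i := by simp
  exact this

theorem zero_mem_ctrlSet (hdu : ∀ i r, 0 < S.du i r) : (0 : S.Ctrl) ∈ S.ctrlSet := fun i => by
  have : S.Cu i *ᵥ (0 : Fin (S.nu i) → ℝ) ≤ S.du i := by
    rw [Matrix.mulVec_zero]; exact fun r => (hdu i r).le
  exact this

theorem isBounded_stateSet (hX : ∀ i, Bornology.IsBounded (S.localStateSet i)) :
    Bornology.IsBounded S.stateSet := by
  choose b hb using fun i => (hX i).exists_norm_le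
  refine isBounded_iff_forall_norm_le.2 ⟨∑ i, |b i|, fun x hx => ?_⟩
  refine (pi_norm_le_iff_of_nonneg (Finset.sum_nonneg fun i _ => abs_nonneg _)).2 fun ⟨i, a⟩ => ?_
  calc ‖x ⟨i, a⟩‖ ≤ ‖fun a => x ⟨i, a⟩‖ := norm_le_pi_norm (fun a => x ⟨i, a⟩) a
    _ ≤ b i := hb i _ (hx i)
    _ ≤ |b i| := le_abs_self _
    _ ≤ _ := Finset.single_le_sum (f := fun i => |b i|) (fun i _ => abs_nonneg _)
      (Finset.mem_univ i)

/-! ### The constants `κ` and `Φ` -/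

theorem stageCost_nonneg (hQ : ∀ i, (S.Q i).PosDef) (hR : ∀ i, (S.R i).PosDef) (x : S.State)
    (u : S.Ctrl) : 0 ≤ S.stageCost x u := by
  have h1 := (S.bigQ_posDef hQ).posSemidef.dotProduct_mulVec_nonneg x
  have h2 := (S.bigR_posDef hR).posSemidef.dotProduct_mulVec_nonneg u
  rw [star_trivial] at h1 h2
  rw [stageCost_eq]
  linarith

theorem stageCost_zero_le (hR : ∀ i, (S.R i).PosDef) (x : S.State) (u : S.Ctrl) :
    S.stageCost x 0 ≤ S.stageCost x u := by
  have h2 := (S.bigR_posDef hR).posSemidef.dotProduct_mulVec_nonneg u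
  rw [star_trivial] at h2
  rw [stageCost_eq, stageCost_eq, zero_dotProduct]
  linarith

theorem stageCost_zero_pos (hQ : ∀ i, (S.Q i).PosDef) {x : S.State} (hx : x ≠ 0) :
    0 < S.stageCost x 0 := by
  have h := (S.bigQ_posDef hQ).dotProduct_mulVec_pos hx
  rw [star_trivial] at h
  rw [stageCost_eq, zero_dotProduct]
  linarith

theorem dotProduct_kappa_matrix_mulVec (κ : ℝ) (z : S.State) :
    z ⬝ᵥ ((κ • S.bigQ - S.Aᵀ * S.bigQ * S.A) *ᵥ z)
      = 2 * (κ * S.stageCost z 0 - S.stageCost (S.A *ᵥ z) 0) := by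
  have h : z ⬝ᵥ ((S.Aᵀ * S.bigQ * S.A) *ᵥ z) = (S.A *ᵥ z) ⬝ᵥ (S.bigQ *ᵥ (S.A *ᵥ z)) := by
    rw [← Matrix.mulVec_mulVec, ← Matrix.mulVec_mulVec, Matrix.dotProduct_mulVec z,
      ← Matrix.mulVec_transpose, Matrix.transpose_transpose]
  rw [Matrix.sub_mulVec, dotProduct_sub, h, Matrix.smul_mulVec, dotProduct_smul, stageCost_eq,
    stageCost_eq, zero_dotProduct, smul_eq_mul]
  ring

/-- Without a member of this set the infimum would be a default value. Any quadratic form is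
dominated by a multiple of a positive definite one. -/
theorem kappa_set_nonempty (hQ : ∀ i, (S.Q i).PosDef) :
    {κ : ℝ | (κ • S.bigQ - S.Aᵀ * S.bigQ * S.A).PosSemidef}.Nonempty := by
  have hQ' := S.bigQ_posDef hQ
  obtain ⟨c, hc, hcle⟩ := hQ'.exists_mul_norm_sq_le
  obtain ⟨C, hC⟩ := Matrix.exists_dotProduct_mulVec_le (S.Aᵀ * S.bigQ * S.A)
  refine ⟨|C| / c, Matrix.PosSemidef.of_dotProduct_mulVec_nonneg ?_ fun z => ?_⟩
  · have hT : S.bigQᵀ = S.bigQ := by simpa using hQ'.isHermitian.eq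
    simp [Matrix.IsHermitian, Matrix.conjTranspose_eq_transpose_of_trivial, hT, Matrix.mul_assoc]
  · rw [star_trivial, Matrix.sub_mulVec, dotProduct_sub, Matrix.smul_mulVec, dotProduct_smul,
      smul_eq_mul]
    have h1 := hC z
    have h2 : |C| / c * (c * ‖z‖ ^ 2) ≤ |C| / c * (z ⬝ᵥ (S.bigQ *ᵥ z)) :=
      mul_le_mul_of_nonneg_left (hcle z) (by positivity)
    have h3 : |C| / c * (c * ‖z‖ ^ 2) = |C| * ‖z‖ ^ 2 := by field_simp
    have h4 : C * ‖z‖ ^ 2 ≤ |C| * ‖z‖ ^ 2 := by gcongr; exact le_abs_self C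
    linarith

theorem stageCost_mulVec_le (hQ : ∀ i, (S.Q i).PosDef) (z : S.State) :
    S.stageCost (S.A *ᵥ z) 0 ≤ S.kappa * S.stageCost z 0 := by
  by_cases hz : z = 0
  · simp [hz, stageCost_eq]
  have hpos := S.stageCost_zero_pos hQ hz
  rw [← div_le_iff₀ hpos]
  refine le_csInf (S.kappa_set_nonempty hQ) fun κ hκ => ?_
  have h : (κ • S.bigQ - S.Aᵀ * S.bigQ * S.A).PosSemidef := hκ
  have h1 := h.dotProduct_mulVec_nonneg z
  rw [star_trivial, dotProduct_kappa_matrix_mulVec] at h1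
  rw [div_le_iff₀ hpos]
  linarith

theorem kappa_nonneg (hQ : ∀ i, (S.Q i).PosDef) (hR : ∀ i, (S.R i).PosDef) {x : S.State}
    (hx : x ≠ 0) : 0 ≤ S.kappa := by
  have h1 := S.stageCost_mulVec_le hQ x
  have h2 := S.stageCost_nonneg hQ hR (S.A *ᵥ x) 0
  exact nonneg_of_mul_nonneg_left (h2.trans h1) (S.stageCost_zero_pos hQ hx)

/-- Uncontrolled stage costs grow at most geometrically; this supplies a linear bound near the
origin for `phi_set_nonempty`. -/
theorem cost_rollout_zero_le (hQ : ∀ i, (S.Q i).PosDef) (hκ : 0 ≤ S.kappa) (x : S.State) :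
    S.cost T (S.rollout T x 0) 0
      ≤ (∑ τ : Fin (T + 1), S.kappa ^ (τ : ℕ)) * S.stageCost x 0 := by
  rw [cost, Finset.sum_mul]
  refine Finset.sum_le_sum fun τ hτ => ?_
  clear hτ
  induction τ using Fin.induction with
  | zero => simp
  | succ τ ih =>
    have h := S.stageCost_mulVec_le hQ (S.rollout T x 0 τ.castSucc)
    rw [rollout_succ, Pi.zero_apply, Pi.zero_apply, Matrix.mulVec_zero, add_zero]
    rw [Pi.zero_apply] at ih
    refine h.trans ((mul_le_mul_of_nonneg_left ih hκ).trans_eq ?_)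
    simp only [Fin.val_castSucc, Fin.val_succ]
    ring

/-- Near the origin the zero input is feasible, so the optimal cost, and with it the last stage
cost, is at most `sκ * ℓ(x, 0)`. Away from the origin the denominator `ℓ(x, v₀)` is bounded below
and the numerator is bounded because the state set is. Adding the two constants covers both cases.
-/
theorem phi_set_nonempty (hQ : ∀ i, (S.Q i).PosDef) (hR : ∀ i, (S.R i).PosDef)
    (hdx : ∀ i r, 0 < S.dx i r) (hdu : ∀ i r, 0 < S.du i r)
    (hX : ∀ i, Bornology.IsBounded (S.localStateSet i)) (hκ : 0 ≤ S.kappa) :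
    {Φ : ℝ | ∀ x ∈ S.feasRegion T 0, ∀ z v, S.IsOptimal T 0 x z v →
      S.minStageCost (z (Fin.last T)) ≤ Φ * S.stageCost x (v 0)}.Nonempty := by
  have hev : ∀ᶠ x : S.State in nhds 0, ∀ τ, S.rollout T x 0 τ ∈ S.stateSet := by
    refine Filter.eventually_all.2 fun τ => ?_
    have hc : Continuous fun x : S.State => S.rollout T x 0 τ :=
      S.continuous_rollout T continuous_id continuous_const τ
    refine hc.continuousAt.eventually_mem ?_
    rw [rollout_zero_zero]
    exact S.stateSet_mem_nhds hdx one_pos S.zero_mem_tightStateSet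
  obtain ⟨r, hr, hball⟩ := Metric.eventually_nhds_iff.1 hev
  obtain ⟨c, hc, hcle⟩ := (S.bigQ_posDef hQ).exists_mul_norm_sq_le
  obtain ⟨b, hb⟩ := (S.isBounded_stateSet hX).exists_norm_le
  obtain ⟨C, hC⟩ := Matrix.exists_dotProduct_mulVec_le S.bigQ
  set sκ := ∑ τ : Fin (T + 1), S.kappa ^ (τ : ℕ)
  have hsum : 0 ≤ sκ := Finset.sum_nonneg fun τ _ => pow_nonneg hκ _
  refine ⟨sκ + |C| * b ^ 2 / (c * r ^ 2), fun x _ z v hopt => ?_⟩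
  rw [(S.isLeast_minStageCost hR hdu _).2]
  have hx0 := S.stageCost_zero_le hR x (v 0)
  have hx00 := S.stageCost_nonneg hQ hR x 0
  have hx00' := hx00.trans hx0
  by_cases hx : ‖x‖ < r
  · have h1 := hopt.2 _ _ (S.feasible_zero_rollout T (hball (by simpa using hx))
      fun τ => S.zero_mem_ctrlSet hdu)
    have h2 := S.cost_rollout_zero_le T hQ hκ x
    have h3 : S.stageCost (z (Fin.last T)) (v (Fin.last T)) ≤ S.cost T z v :=
      Finset.single_le_sum (f := fun τ => S.stageCost (z τ) (v τ))
        (fun τ _ => S.stageCost_nonneg hQ hR _ _) (Finset.mem_univ _)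
    have h4 := S.stageCost_zero_le hR (z (Fin.last T)) (v (Fin.last T))
    have h5 : 0 ≤ |C| * b ^ 2 / (c * r ^ 2) * S.stageCost x (v 0) := by positivity
    have h6 := mul_le_mul_of_nonneg_left hx0 hsum
    linarith
  · have hz : z (Fin.last T) ∈ S.stateSet := by
      rw [← tightStateSet_zero]; exact hopt.1.1 _
    have h1 := hC (z (Fin.last T))
    have h2 : C * ‖z (Fin.last T)‖ ^ 2 ≤ |C| * b ^ 2 := by
      have := hb _ hz
      gcongr
      exact le_abs_self C
    have h3 : c * r ^ 2 ≤ 2 * S.stageCost x (v 0) := by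
      have h4 := hcle x
      have h5 : c * r ^ 2 ≤ c * ‖x‖ ^ 2 := by have := not_lt.1 hx; gcongr
      rw [stageCost_eq, zero_dotProduct] at hx0
      linarith
    have h4 : |C| * b ^ 2 / (c * r ^ 2) * (c * r ^ 2)
        ≤ |C| * b ^ 2 / (c * r ^ 2) * (2 * S.stageCost x (v 0)) :=
      mul_le_mul_of_nonneg_left h3 (by positivity)
    rw [div_mul_cancel₀ _ (by positivity)] at h4
    have h5 := mul_nonneg hsum hx00'
    rw [stageCost_eq, zero_dotProduct]
    linarith

theorem stageCost_last_le_phi (hQ : ∀ i, (S.Q i).PosDef) (hR : ∀ i, (S.R i).PosDef)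
    (hdx : ∀ i r, 0 < S.dx i r) (hdu : ∀ i r, 0 < S.du i r)
    (hX : ∀ i, Bornology.IsBounded (S.localStateSet i)) {x : S.State} (hx : x ≠ 0)
    (hxr : x ∈ S.feasRegion T 0) {z : Fin (T + 1) → S.State} {v : Fin (T + 1) → S.Ctrl}
    (hopt : S.IsOptimal T 0 x z v) :
    0 ≤ S.Phi T ∧ S.stageCost (z (Fin.last T)) 0 ≤ S.Phi T * S.stageCost x (v 0) := by
  have hpos : 0 < S.stageCost x (v 0) :=
    (S.stageCost_zero_pos hQ hx).trans_le (S.stageCost_zero_le hR x (v 0))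
  have h : S.stageCost (z (Fin.last T)) 0 / S.stageCost x (v 0) ≤ S.Phi T := by
    refine le_csInf (S.phi_set_nonempty T hQ hR hdx hdu hX (S.kappa_nonneg hQ hR hx)) fun Φ hΦ => ?_
    rw [div_le_iff₀ hpos, ← (S.isLeast_minStageCost hR hdu _).2]
    exact hΦ x hxr z v hopt
  exact ⟨(div_nonneg (S.stageCost_nonneg hQ hR _ _) hpos.le).trans h, (div_le_iff₀ hpos).1 h⟩

open Filter Topology

/-! ### The tests in terms of real numbers -/

theorem primalCost_of_mem {x : S.State} {v : Fin (T + 1) → S.Ctrl}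
    (h1 : ∀ τ, S.rollout T x v τ ∈ S.stateSet) (h2 : ∀ τ, v τ ∈ S.ctrlSet) :
    S.primalCost T x v = ((S.cost T (S.rollout T x v) v : ℝ) : EReal) :=
  if_pos ⟨h1, h2⟩

theorem mem_of_primalCost_ne_top {x : S.State} {v : Fin (T + 1) → S.Ctrl}
    (h : S.primalCost T x v ≠ ⊤) :
    (∀ τ, S.rollout T x v τ ∈ S.stateSet) ∧ ∀ τ, v τ ∈ S.ctrlSet := by
  by_contra hn
  exact h (if_neg hn)

theorem mem_and_cost_le_of_primalCost_sub_le {x : S.State} {v : Fin (T + 1) → S.Ctrl} {b c : ℝ}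
    (h : S.primalCost T x v - (b : EReal) ≤ (c : EReal)) :
    (∀ τ, S.rollout T x v τ ∈ S.stateSet) ∧ (∀ τ, v τ ∈ S.ctrlSet) ∧
      S.cost T (S.rollout T x v) v - b ≤ c := by
  obtain ⟨h1, h2⟩ := S.mem_of_primalCost_ne_top T (x := x) (v := v) fun ht => by
    rw [ht, EReal.top_sub_coe, top_le_iff] at h
    exact EReal.coe_ne_top _ h
  rw [S.primalCost_of_mem T h1 h2, ← EReal.coe_sub, EReal.coe_le_coe_iff] at h
  exact ⟨h1, h2, h⟩

theorem mem_of_primalCost_add_le {x : S.State} {v : Fin (T + 1) → S.Ctrl} {b c : ℝ}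
    (h : S.primalCost T x v + (b : EReal) ≤ (c : EReal)) :
    ∀ τ, S.rollout T x v τ ∈ S.stateSet :=
  (S.mem_of_primalCost_ne_top T (x := x) (v := v) fun ht => by
    rw [ht, EReal.top_add_coe, top_le_iff] at h
    exact EReal.coe_ne_top _ h).1

/-- The shifted trajectory is the original one advanced by one step, including the new final state
driven by the last control. -/
theorem rollout_shift (x : S.State) (v : Fin (T + 1) → S.Ctrl) (τ : Fin (T + 1)) :
    S.rollout T (S.A *ᵥ x + S.B *ᵥ v 0) (S.shift T v) τ
      = S.A *ᵥ S.rollout T x v τ + S.B *ᵥ v τ := by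
  induction τ using Fin.induction with
  | zero => rfl
  | succ τ ih =>
    rw [rollout_succ, ih, ← rollout_succ, shift, Fin.snoc_castSucc]

theorem primalCost_shift (hdu : ∀ i r, 0 < S.du i r) {x : S.State} {v : Fin (T + 1) → S.Ctrl}
    (h1 : ∀ τ, S.rollout T x v τ ∈ S.stateSet) (h2 : ∀ τ, v τ ∈ S.ctrlSet)
    (h3 : S.A *ᵥ S.rollout T x v (Fin.last T) + S.B *ᵥ v (Fin.last T) ∈ S.stateSet) :
    S.primalCost T (S.A *ᵥ x + S.B *ᵥ v 0) (S.shift T v)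
      = ((S.cost T (S.rollout T x v) v - S.stageCost x (v 0)
          + S.stageCost (S.A *ᵥ S.rollout T x v (Fin.last T) + S.B *ᵥ v (Fin.last T)) 0 : ℝ)
          : EReal) := by
  rw [primalCost_of_mem]
  · congr 1
    rw [cost, cost, Fin.sum_univ_castSucc, Fin.sum_univ_succ]
    simp only [rollout_shift, ← rollout_succ, rollout_zero]
    simp only [shift, Fin.snoc_castSucc, Fin.snoc_last]
    ring
  · intro τ
    rw [rollout_shift]
    induction τ using Fin.lastCases with
    | last => exact h3
    | cast τ => rw [← rollout_succ]; exact h1 _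
  · intro τ
    induction τ using Fin.lastCases with
    | last => rw [shift, Fin.snoc_last]; exact S.zero_mem_ctrlSet hdu
    | cast τ => rw [shift, Fin.snoc_castSucc]; exact h2 _

/-- The last control of an optimal solution vanishes. -/
theorem IsOptimal.ctrl_last {S : DMPC} {T : ℕ} (hR : ∀ i, (S.R i).PosDef)
    (hdu : ∀ i r, 0 < S.du i r) {x : S.State} {z : Fin (T + 1) → S.State}
    {v : Fin (T + 1) → S.Ctrl} (h : S.IsOptimal T 0 x z v) : v (Fin.last T) = 0 := by
  -- The last control influences no state within the horizon, so it can be replaced by `0` at no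
  -- loss.
  have h1 := h.2 z (Function.update v (Fin.last T) 0) ⟨h.1.1, fun τ => ?_, fun τ => ?_, h.1.2.2.2⟩
  · rw [cost, cost, Fin.sum_univ_castSucc, Fin.sum_univ_castSucc, Function.update_self] at h1
    simp only [Function.update_of_ne (Fin.castSucc_lt_last _).ne, add_le_add_iff_left] at h1
    by_contra hne
    have h2 := (S.bigR_posDef hR).dotProduct_mulVec_pos hne
    rw [star_trivial] at h2
    rw [stageCost_eq, stageCost_eq, zero_dotProduct] at h1
    linarith
  · by_cases hτ : τ = Fin.last T
    · rw [hτ, Function.update_self, tightCtrlSet_zero]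
      exact S.zero_mem_ctrlSet hdu
    · rw [Function.update_of_ne hτ]
      exact h.1.2.1 τ
  · rw [Function.update_of_ne (Fin.castSucc_lt_last _).ne]
    exact h.1.2.2.1 τ

/-- At an interior point of the feasible region the constraints can be tightened. -/
theorem exists_feasible_tightened {x : S.State} (hx : x ∈ interior (S.feasRegion T 0)) :
    ∃ η, 0 < η ∧ ∃ z v, S.Feasible T η x z v := by
  have hc : Tendsto (fun t : ℝ => (1 + t) • x) (𝓝 0) (𝓝 x) := by
    have : Continuous fun t : ℝ => (1 + t) • x := by fun_prop
    simpa using this.tendsto 0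
  have hev := hc.eventually (mem_interior_iff_mem_nhds.1 hx)
  obtain ⟨e, hmem, he⟩ := ((hev.filter_mono nhdsWithin_le_nhds).and
    (self_mem_nhdsWithin (s := Set.Ioi (0 : ℝ)))).exists
  have he' : (0 : ℝ) < e := he
  -- A trajectory feasible from `(1 + e) x`, divided by `1 + e`, starts at `x` and satisfies the
  -- constraints tightened by `e / (1 + e)`.
  obtain ⟨-, z, v, ⟨⟨h1, h2, h3, h4⟩, -⟩, -⟩ := hmem
  have hne : (1 + e) ≠ 0 := by positivity
  have hη : 1 - e / (1 + e) = (1 + e)⁻¹ := by field_simp; ring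
  have hinv : 0 ≤ (1 + e)⁻¹ := by positivity
  refine ⟨e / (1 + e), by positivity, fun τ => (1 + e)⁻¹ • z τ, fun τ => (1 + e)⁻¹ • v τ,
    fun τ i => ?_, fun τ i => ?_, fun τ => ?_, ?_⟩
  · have h := h1 τ i
    rw [sub_zero, one_smul] at h
    rw [hη]
    change S.Cx i *ᵥ ((1 + e)⁻¹ • fun a => z τ ⟨i, a⟩) ≤ _
    rw [Matrix.mulVec_smul]
    exact smul_le_smul_of_nonneg_left h hinv
  · have h := h2 τ i
    rw [sub_zero, one_smul] at h
    rw [hη]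
    change S.Cu i *ᵥ ((1 + e)⁻¹ • fun a => v τ ⟨i, a⟩) ≤ _
    rw [Matrix.mulVec_smul]
    exact smul_le_smul_of_nonneg_left h hinv
  · simp only [h3, smul_add, Matrix.mulVec_smul]
  · simp only [h4, smul_smul, inv_mul_cancel₀ hne, one_smul]

theorem vecd_dotProduct_nonneg (hdx : ∀ i r, 0 < S.dx i r) (hdu : ∀ i r, 0 < S.du i r)
    {w : S.Dual T} (hw : ∀ r, 0 ≤ w.2 r) : 0 ≤ S.vecd T ⬝ᵥ w.2 := by
  refine Finset.sum_nonneg fun r _ => mul_nonneg ?_ (hw r)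
  rcases r with r | r
  · exact (hdx _ _).le
  · exact (hdu _ _).le

/-! ### Termination of the loop -/

variable (p : Params)

/-- For fixed tightening, the reduction test holds after finitely many iterations. -/
theorem eventually_reduceTest (hQ : ∀ i, (S.Q i).PosDef) (hR : ∀ i, (S.R i).PosDef)
    (hdx : ∀ i r, 0 < S.dx i r) (hdu : ∀ i r, 0 < S.du i r) (hε : 0 < p.ε) (hδ : 0 < p.δinit)
    {x : S.State} (hx : x ≠ 0) {z₀ : Fin (T + 1) → S.State} {v₀ : Fin (T + 1) → S.Ctrl}
    (h₀ : S.Feasible T 0 x z₀ v₀) (l : ℕ) :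
    ∀ᶠ k in atTop, S.ReduceTest T p x ⟨k, l⟩ := by
  have hL := S.lipConst_pos T hQ hR hx
  have hm : 0 < S.minStageCost x := by
    rw [(S.isLeast_minStageCost hR hdu x).2]
    exact S.stageCost_zero_pos hQ hx
  have hδl : 0 < p.delta l := by unfold Params.delta; positivity
  set δ := p.delta l with hδdef
  have hpos : ∀ k r, 0 ≤ (S.dualIter T δ x k).2 r := S.dualIter_nonneg T δ x
  by_cases hbdd : ∃ M, ∀ w : S.Dual T, (∀ r, 0 ≤ w.2 r) → S.dualFun T δ x w ≤ M
  · set D : Set ℝ := (S.dualFun T δ x) '' {w | ∀ r, 0 ≤ w.2 r} with hD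
    have hne : D.Nonempty := ⟨_, 0, fun _ => le_rfl, rfl⟩
    have hbd : BddAbove D := by
      obtain ⟨M, hM⟩ := hbdd
      exact ⟨M, by rintro _ ⟨w, hw, rfl⟩; exact hM w hw⟩
    obtain ⟨z, v, hzv, hle⟩ := S.exists_feasible_of_dualFun_le T hQ hR (δ := δ) (x := x)
      (M := sSup D) fun w hw => le_csSup hbd ⟨w, hw, rfl⟩
    have hlim : Tendsto (fun k => S.dualFun T δ x (S.dualIter T δ x k)) atTop
        (𝓝 (S.cost T z v)) := by
      refine tendsto_order.2 ⟨fun c hc => ?_, fun c hc => ?_⟩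
      · obtain ⟨_, ⟨w, hw, rfl⟩, hcw⟩ := exists_lt_of_lt_csSup hne (hc.trans_le hle)
        exact S.eventually_lt_dualFun_dualIter T hQ hR hL δ x hw hcw
      · exact Eventually.of_forall fun k => (S.dualFun_le_cost T hQ hR hzv (hpos k)).trans_lt hc
    have hv : Tendsto (fun k => S.ctrlIter T δ x k) atTop (𝓝 v) :=
      S.tendsto_ctrlOf_primalOf T hQ hR hzv hpos hlim
    have hz := hzv.eq_rollout
    have hst : ∀ τ, ∀ᶠ k in atTop, S.rollout T x (S.ctrlIter T δ x k) τ ∈ S.stateSet := by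
      intro τ
      have h1 := ((S.continuous_rollout T (continuous_const (y := x)) continuous_id τ).tendsto
        v).comp hv
      refine h1.eventually (S.stateSet_mem_nhds hdx hδl ?_)
      have := hzv.1 τ
      rwa [hz] at this
    have hct : ∀ τ, ∀ᶠ k in atTop, S.ctrlIter T δ x k τ ∈ S.ctrlSet := fun τ =>
      (tendsto_pi_nhds.1 hv τ).eventually (S.ctrlSet_mem_nhds hdu hδl (hzv.2.1 τ))
    have hcost := (((S.continuous_cost_rollout T x).tendsto v).comp hv).sub hlim
    rw [← hz, sub_self] at hcost
    have hgap : 0 < p.ε / ((l : ℝ) + 1) * S.minStageCost x := by positivity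
    filter_upwards [eventually_all.2 hst, eventually_all.2 hct,
      hcost.eventually_lt_const hgap] with k h1 h2 h3
    refine Or.inl ?_
    rw [S.primalCost_of_mem T h1 h2, ← EReal.coe_sub, EReal.coe_le_coe_iff]
    simp only [Function.comp] at h3
    linarith
  · push Not at hbdd
    -- Dual values above this level exceed the untightened weak-duality bound by more than `ε
    -- ℓ*(x)`, and the excess can only come from `δ dᵀμ`.
    obtain ⟨w, hw, hlt⟩ := hbdd (S.cost T z₀ v₀ + p.ε * S.minStageCost x)
    filter_upwards [S.eventually_lt_dualFun_dualIter T hQ hR hL δ x hw hlt] with k hk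
    refine Or.inr ?_
    have h1 := S.dualFun_shift T δ 0 x (S.dualIter T δ x k)
    have h2 := S.dualFun_le_cost T hQ hR h₀ (hpos k)
    rw [sub_zero] at h1
    change _ < δ * (S.vecd T ⬝ᵥ (S.dualIter T δ x k).2)
    linarith

theorem tendsto_delta : Tendsto p.delta atTop (𝓝 0) := by
  have h := (tendsto_pow_atTop_nhds_zero_of_lt_one (r := (1 / 2 : ℝ)) (by norm_num)
    (by norm_num)).const_mul p.δinit
  rw [mul_zero] at h
  refine h.congr fun l => ?_
  rw [Params.delta, one_div, inv_pow, div_eq_mul_inv]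

/-- The multipliers of the inequality constraints are bounded, uniformly in the number of iterations
and in small enough tightenings. -/
theorem exists_vecd_dotProduct_dualIter_le (hQ : ∀ i, (S.Q i).PosDef) (hR : ∀ i, (S.R i).PosDef)
    (hdx : ∀ i r, 0 < S.dx i r) (hdu : ∀ i r, 0 < S.du i r)
    {x : S.State} (hx : x ≠ 0) {η : ℝ} (hη : 0 < η) {z : Fin (T + 1) → S.State}
    {v : Fin (T + 1) → S.Ctrl} (h : S.Feasible T η x z v) :
    ∃ K, ∀ᶠ l in atTop, ∀ k, S.vecd T ⬝ᵥ (S.dualIter T (p.delta l) x k).2 ≤ K := by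
  have hL := S.lipConst_pos T hQ hR hx
  -- For `δ < η/2`, one has `0 ≤ D^δ = D^η + (δ - η) dᵀμ ≤ cost - (η/2) dᵀμ`.
  refine ⟨S.cost T z v / (η / 2), ?_⟩
  filter_upwards [(tendsto_delta p).eventually_lt_const (half_pos hη)] with l hl k
  have h1 := S.dualFun_shift T (p.delta l) η x (S.dualIter T (p.delta l) x k)
  have h2 := S.dualFun_dualIter_nonneg T hQ hR hL (p.delta l) x k
  have hpos := S.dualIter_nonneg T (p.delta l) x k
  have h3 := S.dualFun_le_cost T hQ hR h hpos
  have h4 := S.vecd_dotProduct_nonneg T hdx hdu hpos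
  rw [le_div_iff₀ (half_pos hη)]
  nlinarith

theorem eventually_stopTest_of_reduceTest (hQ : ∀ i, (S.Q i).PosDef) (hR : ∀ i, (S.R i).PosDef)
    (hdx : ∀ i r, 0 < S.dx i r) (hdu : ∀ i r, 0 < S.du i r)
    (hX : ∀ i, Bornology.IsBounded (S.localStateSet i))
    (hε : 0 < p.ε) (hδ : 0 < p.δinit)
    (hα : p.α ≤ 1 - p.ε
      - S.kappa * (√(2 * p.ε) + √(S.Phi T)) ^ 2 * (√(2 * p.ε) + 1) ^ 2)
    {x : S.State} (hx0 : x ≠ 0) (hx : x ∈ interior (S.feasRegion T 0)) :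
    ∀ᶠ l in atTop, ∀ k, S.ReduceTest T p x ⟨k, l⟩ → S.StopTest T p x ⟨k, l⟩ := by
  have hm : 0 < S.minStageCost x := by
    rw [(S.isLeast_minStageCost hR hdu x).2]
    exact S.stageCost_zero_pos hQ hx0
  obtain ⟨η, hη, zη, vη, hfη⟩ := S.exists_feasible_tightened T hx
  obtain ⟨-, z, v, hopt, hint⟩ := interior_subset hx
  obtain ⟨K, hK⟩ := S.exists_vecd_dotProduct_dualIter_le T p hQ hR hdx hdu hx0 hη hfη
  -- Limits are taken over pairs `(l, k)` with `l → ∞` and `k` unconstrained, restricted to pairs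
  -- passing the reduction test. This yields uniformity in `k`.
  set G : Filter (ℕ × ℕ) := comap Prod.fst atTop with hG
  set F : Filter (ℕ × ℕ) := G ⊓ 𝓟 {q | S.ReduceTest T p x ⟨q.2, q.1⟩} with hF
  suffices h : ∀ᶠ q in F, S.StopTest T p x ⟨q.2, q.1⟩ by
    rw [hF, eventually_inf_principal, hG, eventually_comap] at h
    filter_upwards [h] with l hl k hr
    exact hl ⟨l, k⟩ rfl hr
  have hfst : Tendsto Prod.fst G atTop := tendsto_comap
  have hFG : F ≤ G := inf_le_left
  set w : ℕ × ℕ → S.Dual T := fun q => S.dualIter T (p.delta q.1) x q.2 with hw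
  have hpos : ∀ q r, 0 ≤ (w q).2 r := fun q => S.dualIter_nonneg T _ x _
  have hmu : Tendsto (fun q => p.delta q.1 * (S.vecd T ⬝ᵥ (w q).2)) F (𝓝 0) := by
    have h1 : Tendsto (fun q : ℕ × ℕ => p.delta q.1 * K) F (𝓝 0) := by
      simpa using (((tendsto_delta p).comp hfst).mul_const K).mono_left hFG
    have hδ0 : ∀ l, 0 ≤ p.delta l := fun l => by unfold Params.delta; positivity
    refine tendsto_of_tendsto_of_tendsto_of_le_of_le' tendsto_const_nhds h1
      (Eventually.of_forall fun q =>
        mul_nonneg (hδ0 _) (S.vecd_dotProduct_nonneg T hdx hdu (hpos q)))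
      (hFG ?_)
    filter_upwards [hfst.eventually hK] with q hq
    exact mul_le_mul_of_nonneg_left (hq q.2) (hδ0 _)
  have hsecond := hmu.eventually_lt_const (mul_pos hε hm)
  set u : ℕ × ℕ → Fin (T + 1) → S.Ctrl := fun q => S.ctrlIter T (p.delta q.1) x q.2 with hu
  have hred : ∀ᶠ q in F, (∀ τ, S.rollout T x (u q) τ ∈ S.stateSet) ∧ (∀ τ, u q τ ∈ S.ctrlSet) ∧
      S.cost T (S.rollout T x (u q)) (u q) - p.ε / ((q.1 : ℝ) + 1) * S.minStageCost x
        ≤ S.dualFun T (p.delta q.1) x (w q) := by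
    have hself : ∀ᶠ q in F, S.ReduceTest T p x ⟨q.2, q.1⟩ :=
      eventually_inf_principal.2 (Eventually.of_forall fun _ h => h)
    filter_upwards [hself, hsecond] with q hq hlt
    rcases hq with hq | hq
    · exact S.mem_and_cost_le_of_primalCost_sub_le T hq
    · exact absurd hq hlt.not_gt
  have hsmall : Tendsto (fun q : ℕ × ℕ => p.ε / ((q.1 : ℝ) + 1) * S.minStageCost x) F (𝓝 0) := by
    have h1 : Tendsto (fun l : ℕ => p.ε / ((l : ℝ) + 1)) atTop (𝓝 0) :=
      tendsto_const_div_atTop_nhds_zero_nat p.ε |>.comp (tendsto_add_atTop_nat 1) |>.congr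
        fun l => by simp
    simpa using ((h1.comp hfst).mono_left hFG).mul_const (S.minStageCost x)
  -- The untightened dual value is squeezed: above by weak duality, below because the rollout is
  -- feasible, hence at least optimal in cost, and exceeds the dual value only by the vanishing gap
  -- and `δ dᵀμ`.
  have hlim : Tendsto (fun q => S.dualFun T 0 x (w q)) F (𝓝 (S.cost T z v)) := by
    have h1 := (tendsto_const_nhds (x := S.cost T z v)).sub (hsmall.add hmu)
    rw [add_zero, sub_zero] at h1
    refine tendsto_of_tendsto_of_tendsto_of_le_of_le' h1 tendsto_const_nhds ?_
      (Eventually.of_forall fun q => S.dualFun_le_cost T hQ hR hopt.1 (hpos q))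
    filter_upwards [hred] with q ⟨hq1, hq2, hq3⟩
    have h2 := hopt.2 _ _ (S.feasible_zero_rollout T hq1 hq2)
    have h3 := S.dualFun_shift T (p.delta q.1) 0 x (w q)
    rw [sub_zero] at h3
    linarith
  have hv : Tendsto u F (𝓝 v) := S.tendsto_ctrlOf_primalOf T hQ hR hopt.1 hpos hlim
  have hv0 : Tendsto (fun q => u q 0) F (𝓝 (v 0)) := tendsto_pi_nhds.1 hv 0
  have hnext : Tendsto
      (fun q => S.A *ᵥ S.rollout T x (u q) (Fin.last T) + S.B *ᵥ u q (Fin.last T)) F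
      (𝓝 (S.A *ᵥ z (Fin.last T))) := by
    have hc : Continuous fun v : Fin (T + 1) → S.Ctrl =>
        S.A *ᵥ S.rollout T x v (Fin.last T) + S.B *ᵥ v (Fin.last T) :=
      (continuous_const.matrix_mulVec
        (S.continuous_rollout T continuous_const continuous_id _)).add
        (continuous_const.matrix_mulVec (continuous_apply _))
    have := (hc.tendsto v).comp hv
    rwa [← hopt.1.eq_rollout, hopt.ctrl_last hR hdu, Matrix.mulVec_zero, add_zero] at this
  have hmem := hnext.eventually (mem_interior_iff_mem_nhds.1 hint)
  have hl0 : Tendsto (fun q => S.stageCost x (u q 0)) F (𝓝 (S.stageCost x (v 0))) :=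
    ((S.continuous_stageCost continuous_const continuous_id).tendsto _).comp hv0
  have hlN : Tendsto (fun q => S.stageCost
      (S.A *ᵥ S.rollout T x (u q) (Fin.last T) + S.B *ᵥ u q (Fin.last T)) 0) F
      (𝓝 (S.stageCost (S.A *ᵥ z (Fin.last T)) 0)) :=
    ((S.continuous_stageCost continuous_id continuous_const).tendsto _).comp hnext
  -- This is the exit inequality in the limit. Strictness comes from `ε > 0`, and the square-root
  -- expressions are used only through being at least `Φ` and `1`. The summand `0` is the limit of
  -- the allowed gap.
  have hneg : S.stageCost (S.A *ᵥ z (Fin.last T)) 0 + 0 - (1 - p.α) * S.stageCost x (v 0) < 0 := by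
    obtain ⟨hΦ, hle⟩ := S.stageCost_last_le_phi T hQ hR hdx hdu hX hx0 (interior_subset hx) hopt
    have hκ := S.kappa_nonneg hQ hR hx0
    have h1 := S.stageCost_mulVec_le hQ (z (Fin.last T))
    have h2 := mul_le_mul_of_nonneg_left hle hκ
    have hpos0 : 0 < S.stageCost x (v 0) :=
      (S.stageCost_zero_pos hQ hx0).trans_le (S.stageCost_zero_le hR x (v 0))
    have h3 : S.Phi T ≤ (√(2 * p.ε) + √(S.Phi T)) ^ 2 := by
      have := Real.sq_sqrt hΦ
      nlinarith [Real.sqrt_nonneg (2 * p.ε), Real.sqrt_nonneg (S.Phi T)]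
    have h4 : 1 ≤ (√(2 * p.ε) + 1) ^ 2 := by
      nlinarith [Real.sqrt_nonneg (2 * p.ε)]
    have h5 : S.kappa * S.Phi T
        ≤ S.kappa * (√(2 * p.ε) + √(S.Phi T)) ^ 2 * (√(2 * p.ε) + 1) ^ 2 := by
      calc S.kappa * S.Phi T ≤ S.kappa * (√(2 * p.ε) + √(S.Phi T)) ^ 2 := by gcongr
        _ ≤ _ := le_mul_of_one_le_right (by positivity) h4
    have h6 : S.kappa * S.Phi T < 1 - p.α := by linarith
    have h7 := mul_lt_mul_of_pos_right h6 hpos0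
    linarith
  have hineq := ((hlN.add hsmall).sub (hl0.const_mul (1 - p.α))).eventually_lt_const hneg
  filter_upwards [hred, hsecond, hmem, hineq] with q ⟨hq1, hq2, hq3⟩ hq4 hq5 hq6
  refine ⟨?_, hq4.le⟩
  have hq7 := S.primalCost_shift T hdu hq1 hq2 hq5
  change S.primalCost T (S.A *ᵥ x + S.B *ᵥ u q 0) (S.shift T (u q))
      + ((p.α * S.stageCost x (u q 0) : ℝ) : EReal)
    ≤ ((S.dualFun T (p.delta q.1) x (w q) : ℝ) : EReal)
  rw [hq7, ← EReal.coe_add, EReal.coe_le_coe_iff]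
  linarith

/-! ### Evolution of the loop counters -/

theorem loopState_succ (x : S.State) (j : ℕ) :
    S.loopState T p x (j + 1) = S.loopBody T p x (S.loopState T p x j) :=
  Function.iterate_succ_apply' _ _ _

theorem monotone_loopState_l (x : S.State) : Monotone fun i => (S.loopState T p x i).l := by
  refine monotone_nat_of_le_succ fun i => ?_
  rw [loopState_succ, loopBody]
  split_ifs
  · exact Nat.le_succ _
  · exact le_rfl

theorem loopState_add_of_not_reduceTest (x : S.State) {j : ℕ}
    (h : ∀ i, j ≤ i → ¬ S.ReduceTest T p x (S.loopState T p x i)) (i : ℕ) :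
    S.loopState T p x (j + i)
      = ⟨(S.loopState T p x j).k + i * p.dk, (S.loopState T p x j).l⟩ := by
  induction i with
  | zero => simp
  | succ i ih =>
    rw [← add_assoc, loopState_succ, loopBody, if_neg (h _ (Nat.le_add_right j i)), ih, add_assoc]
    congr 2
    ring

/-- If the reduction test holds after finitely many iterations for every tightening, it holds in
infinitely many passes. -/
theorem exists_reduceTest_ge (hdk : 0 < p.dk) {x : S.State}
    (h : ∀ l, ∀ᶠ k in atTop, S.ReduceTest T p x ⟨k, l⟩) (j : ℕ) :
    ∃ i, j ≤ i ∧ S.ReduceTest T p x (S.loopState T p x i) := by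
  by_contra! hn
  have heq := S.loopState_add_of_not_reduceTest T p x hn
  -- Without resets `k` grows by `dk ≥ 1` per pass, so `k₀` further passes reach the threshold.
  obtain ⟨k₀, hk₀⟩ := eventually_atTop.1 (h (S.loopState T p x j).l)
  refine hn (j + k₀) (Nat.le_add_right _ _) ?_
  rw [heq]
  exact hk₀ _ (by nlinarith)

theorem exists_le_loopState_l (hdk : 0 < p.dk) {x : S.State}
    (h : ∀ l, ∀ᶠ k in atTop, S.ReduceTest T p x ⟨k, l⟩) (n : ℕ) :
    ∃ j, n ≤ (S.loopState T p x j).l := by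
  induction n with
  | zero => exact ⟨0, Nat.zero_le _⟩
  | succ n ih =>
    obtain ⟨j, hj⟩ := ih
    obtain ⟨i, hi, hr⟩ := S.exists_reduceTest_ge T p hdk h j
    refine ⟨i + 1, ?_⟩
    rw [loopState_succ, loopBody, if_pos hr]
    exact Nat.succ_le_succ (hj.trans (S.monotone_loopState_l T p x hi))

/-- At the origin the equality residual vanishes, and `δ ≤ 1` makes each inequality update
nonpositive before clipping, so zero multipliers are a fixed point. -/
theorem accPair_zero {δ : ℝ} (hδ : δ ≤ 1) (hdx : ∀ i r, 0 < S.dx i r) (hdu : ∀ i r, 0 < S.du i r)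
    (k : ℕ) : S.accPair T δ 0 k = (0, 0) := by
  induction k with
  | zero => rfl
  | succ k ih =>
    have hp : S.primalOf T 0 = 0 := by simp [primalOf, dualGrad]
    have hd : ∀ r, 0 ≤ S.vecd T r := by
      rintro (r | r)
      · exact (hdx _ _).le
      · exact (hdu _ _).le
    rw [accPair, ih]
    refine Prod.ext (Prod.ext ?_ (funext fun r => ?_)) rfl
    · simp [accStep, hp]
    · simp only [accStep, hp, sub_self, smul_zero, add_zero, Matrix.mulVec_zero, Prod.snd_zero,
        Pi.zero_apply, mul_zero, zero_add, zero_sub]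
      refine max_eq_left (mul_nonpos_of_nonneg_of_nonpos ?_ ?_)
      · exact one_div_nonneg.2 (norm_nonneg _)
      · exact neg_nonpos.2 (mul_nonneg (sub_nonneg.2 hδ) (hd r))

theorem stopTest_zero (hR : ∀ i, (S.R i).PosDef) (hdx : ∀ i r, 0 < S.dx i r)
    (hdu : ∀ i r, 0 < S.du i r) (hδ : 0 < p.δinit ∧ p.δinit ≤ 1) (s : Counters) :
    S.StopTest T p 0 s := by
  have hδl : p.delta s.l ≤ 1 := by
    unfold Params.delta
    exact (div_le_self hδ.1.le (one_le_pow₀ one_le_two)).trans hδ.2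
  have hw : S.dualIter T (p.delta s.l) 0 s.k = 0 := by
    rw [dualIter, S.accPair_zero T hδl hdx hdu]
  have hu : S.ctrlIter T (p.delta s.l) 0 s.k = 0 := by
    rw [ctrlIter, hw]
    ext τ c
    simp [ctrlOf, primalOf, dualGrad]
  have hm : S.minStageCost 0 = 0 := by
    rw [(S.isLeast_minStageCost hR hdu 0).2]; simp [stageCost_eq]
  have h0 : (0 : S.State) ∈ S.stateSet :=
    mem_of_mem_nhds (S.stateSet_mem_nhds hdx one_pos S.zero_mem_tightStateSet)
  have hpc := S.primalCost_shift T hdu (x := 0) (v := 0) (fun τ => by rwa [rollout_zero_zero])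
    (fun τ => S.zero_mem_ctrlSet hdu) (by rw [rollout_zero_zero]; simpa using h0)
  refine ⟨?_, ?_⟩
  · rw [hw, hu, hpc, ← EReal.coe_add, EReal.coe_le_coe_iff, rollout_zero_zero]
    simp [cost, rollout_zero_zero, stageCost_eq, dualFun, dualGrad]
  · rw [hw, hm]
    simp

end DMPC

end

theorem mainTheorem3 (S : DMPC) (T : ℕ) (p : DMPC.Params)
    (hQ : ∀ i, (S.Q i).PosDef) (hR : ∀ i, (S.R i).PosDef)
    (hdx : ∀ i r, 0 < S.dx i r) (hdu : ∀ i r, 0 < S.du i r)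
    (hX : ∀ i, Bornology.IsBounded (S.localStateSet i))
    (hU : ∀ i, Bornology.IsBounded (S.localCtrlSet i))
    (hε : 0 < p.ε) (hδ : 0 < p.δinit ∧ p.δinit ≤ 1) (hdk : 0 < p.dk)
    (hα : p.α ≤ 1 - p.ε
      - S.kappa * (√(2 * p.ε) + √(S.Phi T)) ^ 2 * (√(2 * p.ε) + 1) ^ 2)
    (x : S.State) (hx : x ∈ interior (S.feasRegion T 0)) :
    ∃ h : x ∈ (S.feedback T p).Dom,
      S.A.mulVec x + S.B.mulVec ((S.feedback T p).fn x h) ∈ S.stateSet := by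
  have h : ∃ j, S.StopTest T p x (S.loopState T p x (j + 1)) := by
    by_cases hx0 : x = 0
    · subst hx0
      exact ⟨0, S.stopTest_zero T p hR hdx hdu hδ _⟩
    obtain ⟨-, z, v, hopt, -⟩ := interior_subset hx
    have hred := S.eventually_reduceTest T p hQ hR hdx hdu hε hδ.1 hx0 hopt.1
    obtain ⟨l₀, hl₀⟩ := Filter.eventually_atTop.1
      (S.eventually_stopTest_of_reduceTest T p hQ hR hdx hdu hX hε hδ.1 hα hx0 hx)
    obtain ⟨j, hj⟩ := S.exists_le_loopState_l T p hdk hred l₀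
    -- The exit test is evaluated only after a pass, so the state sought must have positive index;
    -- starting from `j + 1` ensures this. At that state the exit test precedes the pending
    -- reduction and sees the same counters.
    obtain ⟨i, hi, hr⟩ := S.exists_reduceTest_ge T p hdk hred (j + 1)
    obtain ⟨i, rfl⟩ : ∃ n, i = n + 1 := ⟨i - 1, by omega⟩
    exact ⟨i, hl₀ _ (hj.trans (S.monotone_loopState_l T p x ((Nat.le_succ j).trans hi))) _ hr⟩
  refine ⟨h, ?_⟩
  have hs := @Nat.find_spec _ (fun _ => Classical.propDecidable _) h
  exact S.mem_of_primalCost_add_le T hs.1 0
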